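/- Let $k$ be a field and let $A=\bigoplus_{i\ge 0}A_i$ be an $\mathbb N$-graded $k$-algebra with $\dim_k A_i<\infty$ for all $i$ that is left noetherian (in particular, this covers every two-sided noetherian $A$). Let $\mathrm{Gr}\,A$ be the category of $\mathbb Z$-graded left $A$-modules with degree-zero morphisms, with shifts $M(\ell)_m=M_{m+\ell}$, and let $\mathbf D^-(\mathrm{gr}\,A)$ (resp. $\mathbf D^b(\mathrm{gr}\,A)$) be the full subcategory of $\mathbf D(\mathrm{Gr}\,A)$ of the objects with bounded above (resp. bounded) cohomology that is finitely generated in each cohomological degree. Let $J$ be the graded Jacobson radical of $A$ (the intersection of the maximal homogeneous left ideals) and $S=A/J$. For $X\in\mathbf D^-(\mathrm{gr}\,A)$, $Y\in\mathrm{Gr}\,A$ and $i,j\in\mathbb Z$ put $$\underline{\mathrm{Ext}}^i_A(X,Y)_j=\mathrm{Hom}_{\mathbf D(\mathrm{Gr}\,A)}(X,Y(j)[i]),\qquad \mathrm{ideg}\,R\underline{\mathrm{Hom}}_A(X,Y)=\inf\{\,i+j : \underline{\mathrm{Ext}}^i_A(X,Y)_j\ne 0\,\},$$ where infima and suprema are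 taken in $\mathbb Z\cup\{\pm\infty\}$, with $\inf\emptyset=+\infty$ and $\sup\emptyset=-\infty$. Put $\mathrm{Extreg}(X)=-\mathrm{ideg}\,R\underline{\mathrm{Hom}}_A(X,S)$ and $\mathrm{pdim}(X)=\sup\{\,i\in\mathbb Z : \underline{\mathrm{Ext}}^i_A(X,Y)\ne 0\text{ for some }Y\in\mathrm{Gr}\,A\,\}$. (1) For every nonzero $X\in\mathbf D^-(\mathrm{gr}\,A)$, in particular for every nonzero $X\in\mathbf D^b(\mathrm{gr}\,A)$, $$\mathrm{Extreg}(X)\ \ge\ -\mathrm{ideg}\,R\underline{\mathrm{Hom}}_A(X,A).$$ (2) If moreover $A_0$ is semisimple, then for every nonzero $X\in\mathbf D^b(\mathrm{gr}\,A)$ with $\mathrm{pdim}(X)<\infty$, $$\mathrm{Extreg}(X)\ =\ -\mathrm{ideg}\,R\underline{\mathrm{Hom}}_A(X,A).$$ -/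

import Mathlib

open CategoryTheory CategoryTheory.Limits

universe v u

noncomputable section

/-- A `ℤ`-graded left module `M = ⨁ M_j` over an `ℕ`-graded `k`-algebra `A = ⨁ 𝒜 i`, given by its
homogeneous components `M_j = M.obj j` and the action maps `A_i × M_j → M_l`, `l = i + j`.
(The action of `k` is the one through `k → A_0`.) -/
structure GrMod {k : Type v} [Field k] {A : Type u} [Ring A] [Algebra k A]
    (𝒜 : ℕ → Submodule k A) [GradedAlgebra 𝒜] where
  /-- the homogeneous component of degree `j` -/
  obj : ℤ → Type u
  [grp : ∀ j, AddCommGroup (obj j)]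
  /-- the action of `A_i` on `M_j` -/
  act : ∀ {i : ℕ} {j l : ℤ}, (i : ℤ) + j = l → 𝒜 i →+ obj j →+ obj l
  one_act : ∀ {j : ℤ} (h : ((0 : ℕ) : ℤ) + j = j) (m : obj j),
    act h ⟨1, SetLike.one_mem_graded 𝒜⟩ m = m
  mul_act : ∀ {i i' : ℕ} {j l p : ℤ} (h : (i' : ℤ) + j = l) (h' : (i : ℤ) + l = p)
    (h'' : ((i + i' : ℕ) : ℤ) + j = p) (a : 𝒜 i) (b : 𝒜 i') (m : obj j),
    act h'' ⟨a * b, SetLike.mul_mem_graded a.2 b.2⟩ m = act h' a (act h b m)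

namespace GrMod

variable {k : Type v} [Field k] {A : Type u} [Ring A] [Algebra k A]
  {𝒜 : ℕ → Submodule k A} [GradedAlgebra 𝒜]

attribute [instance] GrMod.grp

/-- Morphisms in `Gr A`: `A`-linear maps of degree zero. -/
@[ext]
structure Hom (M N : GrMod 𝒜) where
  /-- the components of the morphism -/
  app : ∀ j, M.obj j →+ N.obj j
  map_act : ∀ {i : ℕ} {j l : ℤ} (h : (i : ℤ) + j = l) (a : 𝒜 i) (m : M.obj j),
    app l (M.act h a m) = N.act h a (app j m)

/-- The category `Gr A`. -/
instance : Category (GrMod 𝒜) where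
  Hom M N := Hom M N
  id M := ⟨fun _ => AddMonoidHom.id _, fun _ _ _ => rfl⟩
  comp f g := ⟨fun j => (g.app j).comp (f.app j), fun h a m => by
    simp [f.map_act, g.map_act]⟩

@[ext]
lemma hom_ext {M N : GrMod 𝒜} {f g : M ⟶ N} (h : ∀ j (m : M.obj j), f.app j m = g.app j m) :
    f = g :=
  Hom.ext (funext fun j => AddMonoidHom.ext (h j))

@[simp] lemma id_app (M : GrMod 𝒜) (j : ℤ) (m : M.obj j) : (𝟙 M : M ⟶ M).app j m = m := rfl

@[simp] lemma comp_app {M N P : GrMod 𝒜} (f : M ⟶ N) (g : N ⟶ P) (j : ℤ) (m : M.obj j) :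
    (f ≫ g).app j m = g.app j (f.app j m) := rfl

lemma app_act {M N : GrMod 𝒜} (f : M ⟶ N) {i : ℕ} {j l : ℤ} (h : (i : ℤ) + j = l) (a : 𝒜 i)
    (m : M.obj j) : f.app l (M.act h a m) = N.act h a (f.app j m) := Hom.map_act f h a m

section Additive

variable {M N : GrMod 𝒜}

instance : Zero (M ⟶ N) := ⟨⟨fun _ => 0, fun _ _ _ => by simp⟩⟩
instance : Add (M ⟶ N) :=
  ⟨fun f g => ⟨fun j => f.app j + g.app j, fun h a m => by simp [app_act]⟩⟩
instance : Neg (M ⟶ N) := ⟨fun f => ⟨fun j => - f.app j, fun h a m => by simp [app_act]⟩⟩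

@[simp] lemma zero_app (j : ℤ) (m : M.obj j) : (0 : M ⟶ N).app j m = 0 := rfl
@[simp] lemma add_app (f g : M ⟶ N) (j : ℤ) (m : M.obj j) :
    (f + g).app j m = f.app j m + g.app j m := rfl
@[simp] lemma neg_app (f : M ⟶ N) (j : ℤ) (m : M.obj j) : (-f).app j m = -(f.app j m) := rfl

instance : AddCommGroup (M ⟶ N) where
  add_assoc f g h := by ext; simp [add_assoc]
  zero_add f := by ext; simp
  add_zero f := by ext; simp
  nsmul := nsmulRec
  zsmul := zsmulRec
  neg_add_cancel f := by ext; simp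
  add_comm f g := by ext; simp [add_comm]

end Additive

instance : Preadditive (GrMod 𝒜) where
  add_comp _ _ _ f f' g := by ext; simp
  comp_add _ _ _ f g g' := by ext; simp

/-! ### Kernels, cokernels and finite products in `Gr A` -/

/-- The zero graded module. -/
def zeroMod : GrMod 𝒜 where
  obj _ := PUnit
  act _ := 0
  one_act _ _ := rfl
  mul_act _ _ _ _ _ _ := rfl

instance : HasZeroObject (GrMod 𝒜) :=
  ⟨⟨zeroMod, ⟨fun _ => ⟨⟨⟨0⟩, fun f => by
      ext j m
      rw [show m = 0 from rfl, map_zero, map_zero]⟩⟩,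
    fun _ => ⟨⟨⟨0⟩, fun f => by ext; rfl⟩⟩⟩⟩⟩

/-- The direct sum of two graded modules. -/
def prodMod (M N : GrMod 𝒜) : GrMod 𝒜 where
  obj j := M.obj j × N.obj j
  act h := AddMonoidHom.mk' (fun a => (M.act h a).prodMap (N.act h a)) (fun a b => by
    ext <;> simp)
  one_act h m := by ext <;> simp [M.one_act, N.one_act]
  mul_act h h' h'' a b m := by
    ext
    · simp [M.mul_act h h' h'']
    · simp [N.mul_act h h' h'']

instance : HasBinaryProducts (GrMod 𝒜) := by
  have (M N : GrMod 𝒜) : HasBinaryProduct M N := by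
    let p : prodMod M N ⟶ M := ⟨fun _ => AddMonoidHom.fst _ _, fun _ _ _ => rfl⟩
    let q : prodMod M N ⟶ N := ⟨fun _ => AddMonoidHom.snd _ _, fun _ _ _ => rfl⟩
    refine ⟨⟨⟨BinaryFan.mk p q, BinaryFan.IsLimit.mk _
      (fun {T} f g => ⟨fun j => (f.app j).prod (g.app j), fun h a m => ?_⟩) ?_ ?_ ?_⟩⟩⟩
    · exact Prod.ext (app_act f h a m) (app_act g h a m)
    · intros; rfl
    · intros; rfl
    · rintro T f g m rfl rfl
      rfl
  exact hasBinaryProducts_of_hasLimit_pair _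

/-- The kernel of a morphism, computed degreewise. -/
def kerMod {M N : GrMod 𝒜} (f : M ⟶ N) : GrMod 𝒜 where
  obj j := (f.app j).ker
  act {i j l} h := AddMonoidHom.mk' (fun a => ((M.act h a).comp (f.app j).ker.subtype).codRestrict
      (f.app l).ker (fun m => by
        have := m.2
        rw [AddMonoidHom.mem_ker] at this ⊢
        simp [app_act, this])) (fun a b => by ext; simp)
  one_act h m := by ext; simp [M.one_act]
  mul_act h h' h'' a b m := by ext; simp [M.mul_act h h' h'']

/-- The inclusion of the kernel. -/
def kerι {M N : GrMod 𝒜} (f : M ⟶ N) : kerMod f ⟶ M :=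
  ⟨fun j => (f.app j).ker.subtype, fun _ _ _ => rfl⟩

lemma kerι_comp {M N : GrMod 𝒜} (f : M ⟶ N) : kerι f ≫ f = 0 := by
  ext j m
  exact m.2

/-- A morphism that is injective in every degree and whose image is the kernel of `g` is a
kernel of `g`. -/
def isLimitOfExact {K M N : GrMod 𝒜} (ι : K ⟶ M) (g : M ⟶ N) (w : ι ≫ g = 0)
    (hi : ∀ j, Function.Injective (ι.app j))
    (he : ∀ j m, g.app j m = 0 → ∃ x, ι.app j x = m) :
    IsLimit (KernelFork.ofι ι w) := by
  have key : ∀ {W : GrMod 𝒜} (t : W ⟶ M) (_ : t ≫ g = 0) (j : ℤ) (x : W.obj j),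
      ∃ y, ι.app j y = t.app j x := fun t ht j x => he j _ (by
    rw [← comp_app, ht, zero_app])
  choose s hs using @key
  exact KernelFork.IsLimit.ofι ι w
    (fun t ht => ⟨fun j => AddMonoidHom.mk' (s t ht j) (fun x y => hi j (by simp [hs])),
      fun h a m => hi _ (by simp [hs, app_act])⟩)
    (fun t ht => by
      ext j x
      exact hs t ht j x)
    (fun t ht b hb => by
      ext j x
      refine hi j ?_
      rw [← comp_app, hb]
      exact (hs t ht j x).symm)

instance : HasKernels (GrMod 𝒜) where
  has_limit f := ⟨⟨⟨_, isLimitOfExact (kerι f) f (kerι_comp f)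
    (fun _ => Subtype.val_injective) (fun _ m hm => ⟨⟨m, hm⟩, rfl⟩)⟩⟩⟩

/-- The cokernel of a morphism, computed degreewise. -/
def cokerMod {M N : GrMod 𝒜} (f : M ⟶ N) : GrMod 𝒜 where
  obj j := N.obj j ⧸ (f.app j).range
  act {i j l} h := AddMonoidHom.mk' (fun a => QuotientAddGroup.map _ _ (N.act h a) (by
      rintro _ ⟨m, rfl⟩
      exact ⟨M.act h a m, app_act f h a m⟩)) (fun a b => by ext; simp)
  one_act h m := by
    obtain ⟨m, rfl⟩ := QuotientAddGroup.mk_surjective m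
    simp [N.one_act]
  mul_act h h' h'' a b m := by
    obtain ⟨m, rfl⟩ := QuotientAddGroup.mk_surjective m
    simp [N.mul_act h h' h'']

/-- The projection to the cokernel. -/
def cokerπ {M N : GrMod 𝒜} (f : M ⟶ N) : N ⟶ cokerMod f :=
  ⟨fun j => QuotientAddGroup.mk' (f.app j).range, fun _ _ _ => rfl⟩

lemma comp_cokerπ {M N : GrMod 𝒜} (f : M ⟶ N) : f ≫ cokerπ f = 0 := by
  ext j m
  exact (QuotientAddGroup.eq_zero_iff _).2 ⟨m, rfl⟩

/-- A morphism that is surjective in every degree and whose kernel is the image of `g` is a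
cokernel of `g`. -/
def isColimitOfExact {M N C : GrMod 𝒜} (g : M ⟶ N) (π : N ⟶ C) (w : g ≫ π = 0)
    (hs : ∀ j, Function.Surjective (π.app j))
    (he : ∀ j n, π.app j n = 0 → ∃ x, g.app j x = n) :
    IsColimit (CokernelCofork.ofπ π w) := by
  have key : ∀ {W : GrMod 𝒜} (t : N ⟶ W) (_ : g ≫ t = 0) (j : ℤ) (x y : N.obj j),
      π.app j x = π.app j y → t.app j x = t.app j y := fun t ht j x y hxy => by
    obtain ⟨z, hz⟩ := he j (x - y) (by rw [map_sub, hxy, sub_self])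
    rw [← sub_eq_zero, ← map_sub, ← hz, ← comp_app, ht, zero_app]
  choose s hs' using hs
  have key' : ∀ {W : GrMod 𝒜} (t : N ⟶ W) (_ : g ≫ t = 0) (j : ℤ) (x : N.obj j),
      t.app j (s j (π.app j x)) = t.app j x := fun t ht j x => key t ht j _ _ (hs' j _)
  exact CokernelCofork.IsColimit.ofπ π w
    (fun t ht => ⟨fun j => AddMonoidHom.mk' (fun c => t.app j (s j c)) (fun x y => by
        rw [← map_add]
        exact key t ht j _ _ (by simp [hs'])),
      fun h a m => by
        simp only [AddMonoidHom.mk'_apply]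
        rw [← app_act]
        exact key t ht _ _ _ (by simp [hs', app_act])⟩)
    (fun t ht => by
      ext j x
      exact key' t ht j x)
    (fun t ht b hb => by
      ext j x
      have := congrArg (fun q : N ⟶ _ => q.app j (s j x)) hb
      simpa [hs'] using this)

instance : HasCokernels (GrMod 𝒜) where
  has_colimit f := ⟨⟨⟨_, isColimitOfExact f (cokerπ f) (comp_cokerπ f)
    (fun _ => QuotientAddGroup.mk_surjective)
    (fun _ _ hm => (QuotientAddGroup.eq_zero_iff _).1 hm)⟩⟩⟩

lemma injective_of_mono {M N : GrMod 𝒜} (f : M ⟶ N) [Mono f] (j : ℤ) :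
    Function.Injective (f.app j) := by
  have h : kerι f = 0 := by
    rw [← cancel_mono f, kerι_comp, zero_comp]
  rw [injective_iff_map_eq_zero]
  intro m hm
  exact congrArg (fun q : kerMod f ⟶ M => q.app j ⟨m, hm⟩) h

lemma surjective_of_epi {M N : GrMod 𝒜} (f : M ⟶ N) [Epi f] (j : ℤ) :
    Function.Surjective (f.app j) := by
  have h : cokerπ f = 0 := by
    rw [← cancel_epi f, comp_cokerπ, comp_zero]
  intro n
  exact (QuotientAddGroup.eq_zero_iff _).1 (congrArg (fun q : N ⟶ cokerMod f => q.app j n) h)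

/-- `Gr A` is an abelian category. -/
instance : Abelian (GrMod 𝒜) where
  normalMonoOfMono f _ := ⟨
    { Z := _
      g := cokerπ f
      w := comp_cokerπ f
      isLimit := isLimitOfExact f _ _ (injective_of_mono f)
        (fun _ _ hm => (QuotientAddGroup.eq_zero_iff _).1 hm) }⟩
  normalEpiOfEpi f _ := ⟨
    { W := _
      g := kerι f
      w := kerι_comp f
      isColimit := isColimitOfExact _ f _ (surjective_of_epi f)
        (fun _ n hn => ⟨⟨n, hn⟩, rfl⟩) }⟩
  has_finite_products := hasFiniteProducts_of_has_binary_and_terminal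

/-- The derived category `D(Gr A)` is `DerivedCategory (GrMod 𝒜)`. -/
instance : HasDerivedCategory (GrMod 𝒜) := HasDerivedCategory.standard _

/-! ### Graded modules -/

/-- The shift `M(ℓ)`, with `M(ℓ)_m = M_{m + ℓ}`. -/
def shift (M : GrMod 𝒜) (ℓ : ℤ) : GrMod 𝒜 where
  obj m := M.obj (m + ℓ)
  act h := M.act (by omega)
  one_act _ m := M.one_act _ m
  mul_act _ _ _ a b m := M.mul_act _ _ _ a b m

/-- `M` is finitely generated: there are finitely many homogeneous elements `x t` such that every
homogeneous element is a finite sum of elements `a • x t`, `a` homogeneous. -/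
def FinGen (M : GrMod 𝒜) : Prop :=
  ∃ (n : ℕ) (d : Fin n → ℤ) (x : ∀ t, M.obj (d t)), ∀ (l : ℤ) (m : M.obj l),
    m ∈ AddSubgroup.closure
      {y : M.obj l | ∃ (t : Fin n) (i : ℕ) (h : (i : ℤ) + d t = l) (a : 𝒜 i), y = M.act h a (x t)}

variable (𝒜) in
/-- The component `A_n` for `n : ℤ`, with `A_n = 0` for `n < 0`. -/
def comp : ℤ → Submodule k A
  | Int.ofNat n => 𝒜 n
  | Int.negSucc _ => ⊥

lemma mul_mem_comp {i : ℕ} {j l : ℤ} (h : (i : ℤ) + j = l) {a b : A} (ha : a ∈ 𝒜 i)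
    (hb : b ∈ comp 𝒜 j) : a * b ∈ comp 𝒜 l := by
  subst h
  cases j with
  | ofNat n => exact SetLike.mul_mem_graded (A := 𝒜) ha hb
  | negSucc n =>
    rw [show b = 0 from hb, mul_zero]
    exact zero_mem _

variable (𝒜) in
/-- `A` as a graded left module over itself. -/
def regular : GrMod 𝒜 where
  obj n := comp 𝒜 n
  act h := AddMonoidHom.mk'
    (fun a => AddMonoidHom.mk' (fun m => ⟨a * m, mul_mem_comp h a.2 m.2⟩)
      (fun x y => Subtype.ext (mul_add _ _ _)))
    (fun a b => by
      ext x
      exact add_mul _ _ _)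
  one_act _ m := Subtype.ext (one_mul _)
  mul_act _ _ _ a b m := Subtype.ext (mul_assoc _ _ _)

/-- The homogeneous component of degree `n` of a homogeneous left ideal, as a subgroup of `A_n`. -/
def idealComp (I : HomogeneousIdeal 𝒜) (n : ℤ) : AddSubgroup (comp 𝒜 n) :=
  I.toIdeal.toAddSubgroup.comap (comp 𝒜 n).toAddSubgroup.subtype

/-- The graded left module `A / I` for a homogeneous left ideal `I`. -/
def quot (I : HomogeneousIdeal 𝒜) : GrMod 𝒜 where
  obj n := comp 𝒜 n ⧸ idealComp I n
  act h := AddMonoidHom.mk'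
    (fun a => QuotientAddGroup.map _ _ ((regular 𝒜).act h a)
      (fun x hx => I.toIdeal.mul_mem_left (a : A) hx))
    (fun a b => by
      ext x
      exact congrArg (QuotientAddGroup.mk' _) (congrArg (fun f => f x)
        (map_add ((regular 𝒜).act h) a b)))
  one_act h m := by
    obtain ⟨m, rfl⟩ := QuotientAddGroup.mk_surjective m
    exact congrArg _ ((regular 𝒜).one_act h m)
  mul_act h h' h'' a b m := by
    obtain ⟨m, rfl⟩ := QuotientAddGroup.mk_surjective m
    exact congrArg _ ((regular 𝒜).mul_act h h' h'' a b m)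

variable (𝒜) in
/-- The graded Jacobson radical `J` of `A`: the intersection of the maximal homogeneous
left ideals. -/
def gradedJacobson : HomogeneousIdeal 𝒜 := sInf {I | IsCoatom I}

variable (𝒜) in
/-- The graded left module `S = A / J`. -/
def topMod : GrMod 𝒜 := quot (gradedJacobson 𝒜)

/-! ### Complexes of graded modules -/

/-- The `i`-th cohomology `H^i(X)` of an object of `D(Gr A)`. -/
abbrev cohomology (X : DerivedCategory (GrMod 𝒜)) (i : ℤ) : GrMod 𝒜 :=
  (DerivedCategory.homologyFunctor (GrMod 𝒜) i).obj X

/-- `X` lies in `D⁻(gr A)`: its cohomology is bounded above and finitely generated in each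
cohomological degree. -/
def IsDMinusFG (X : DerivedCategory (GrMod 𝒜)) : Prop :=
  (∃ n : ℤ, ∀ i, n < i → IsZero (cohomology X i)) ∧ ∀ i, (cohomology X i).FinGen

/-- `X` lies in `Dᵇ(gr A)`: its cohomology is bounded and finitely generated in each
cohomological degree. -/
def IsDBoundedFG (X : DerivedCategory (GrMod 𝒜)) : Prop :=
  (∃ n : ℤ, ∀ i, n < i → IsZero (cohomology X i)) ∧
    (∃ n : ℤ, ∀ i, i < n → IsZero (cohomology X i)) ∧ ∀ i, (cohomology X i).FinGen

/-- For a graded module `Y`, the component of degree `j` of the `i`-th cohomology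
`Ext^i_A(X, Y)` of the graded derived Hom complex `R Hom_A(X, Y)`: the group
`Hom_{D(Gr A)}(X, Y(j)[i])`. -/
abbrev gExt (X : DerivedCategory (GrMod 𝒜)) (Y : GrMod 𝒜) (i j : ℤ) : Type _ :=
  X ⟶ (shiftFunctor (DerivedCategory (GrMod 𝒜)) i).obj
    ((DerivedCategory.singleFunctor (GrMod 𝒜) 0).obj (Y.shift j))

/-- The infimum degree of `R Hom_A(X, Y)`: the infimum of the `i + j` such that
`Ext^i_A(X, Y)_j ≠ 0` (it is `+∞` if there are none). -/
def idegRHom (X : DerivedCategory (GrMod 𝒜)) (Y : GrMod 𝒜) : EReal :=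
  sInf {e : EReal | ∃ i j : ℤ, Nontrivial (gExt X Y i j) ∧ e = ((i + j : ℤ) : ℝ)}

/-- The Ext-regularity `Extreg(X) = - ideg R Hom_A(X, S)`. -/
def extReg (X : DerivedCategory (GrMod 𝒜)) : EReal := - idegRHom X (topMod 𝒜)

/-- The projective dimension of `X`: the supremum of the `i` such that `Ext^i_A(X, Y) ≠ 0` for
some graded module `Y`. -/
def pdim (X : DerivedCategory (GrMod 𝒜)) : EReal :=
  sSup {e : EReal | ∃ (i : ℤ) (Y : GrMod 𝒜), (∃ j : ℤ, Nontrivial (gExt X Y i j)) ∧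
    e = ((i : ℤ) : ℝ)}

end GrMod

end

noncomputable section

namespace GrMod

variable {k : Type v} [Field k] {A : Type u} [Ring A] [Algebra k A]
  {𝒜 : ℕ → Submodule k A} [GradedAlgebra 𝒜]

/-! ### Short exact sequences in `Gr A` -/

/-! Both parts are a dévissage of `A(j)` by degree. `S` is concentrated in degree `0`, where it is
`A₀` modulo its radical; hence every simple `A₀`-module placed in degree `d` is a retract of `S(-d)`
(`zeroPart_gradedJacobson`, `exists_retract_of_ker_eq_jacobson`). The module `A(j)` lives in degrees
`≥ -j`, with components of finite length over the artinian ring `A₀`.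

(1) Suppose `Ext^i(X, S)_s = 0` for all `s ≤ j`. Then `Ext^i(X, -)` kills every degree piece of
`A(j)`, hence `A(j)/A(j)_{≥ n}` for every `n`. The tail is killed too: since `A` is left noetherian,
`Ext^i(X, Y) = 0` once `Y` lives in degrees `≥ n(X, i)` (`IsDMinusFG.exists_extVanish`), so no limit
argument is needed. Thus `Ext^i(X, A)_j ≠ 0` forces `Ext^i(X, S)_s ≠ 0` for some `s ≤ j`.

(2) If `pdim X < ∞`, the numbers `i + j` with `Ext^i(X, S)_j ≠ 0` are bounded below. Take the least
such sum `e`, and the largest `i` attaining it. When `A₀` is semisimple, `S(j)` is a retract of the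
lowest piece of `A(j)`. If `Ext^i(X, A)_j` vanished, a nonzero class in `Ext^i(X, S)_j` would inject
into `Ext^{i+1}(X, A(j)_{≥ -j+1})`. The latter is controlled by the `Ext^{i+1}(X, S)_s` with `s <
j`, all zero: by minimality of `e` if `s < j - 1`, by maximality of `i` if `s = j - 1`
(`extVanish_topMod_of_regular`, `idegRHom_regular_le`). -/

lemma mono_of_injective {M N : GrMod 𝒜} (f : M ⟶ N) (hf : ∀ j, Function.Injective (f.app j)) :
    Mono f := by
  refine Preadditive.mono_of_cancel_zero f fun {W} g hg => ?_
  ext j x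
  refine hf j ?_
  rw [← comp_app, hg, zero_app, zero_app, map_zero]

lemma epi_of_surjective {M N : GrMod 𝒜} (f : M ⟶ N) (hf : ∀ j, Function.Surjective (f.app j)) :
    Epi f := by
  refine Preadditive.epi_of_cancel_zero f fun {W} g hg => ?_
  ext j x
  obtain ⟨y, rfl⟩ := hf j x
  rw [← comp_app, hg, zero_app, zero_app]

lemma shortExact_of_exact {K M N : GrMod 𝒜} (f : K ⟶ M) (g : M ⟶ N) (w : f ≫ g = 0)
    (hf : ∀ j, Function.Injective (f.app j)) (hg : ∀ j, Function.Surjective (g.app j))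
    (he : ∀ j m, g.app j m = 0 → ∃ x, f.app j x = m) : (ShortComplex.mk f g w).ShortExact :=
  { exact := ShortComplex.exact_of_f_is_kernel _ (isLimitOfExact f g w hf he)
    mono_f := mono_of_injective f hf
    epi_g := epi_of_surjective g hg }

lemma isIso_of_bijective {M N : GrMod 𝒜} (f : M ⟶ N)
    (hf : ∀ j, Function.Bijective (f.app j)) : IsIso f := by
  have := mono_of_injective f fun j => (hf j).1
  have := epi_of_surjective f fun j => (hf j).2
  exact isIso_of_mono_of_epi f

/-! ### The homogeneous components as `A₀`-modules -/

instance zeroModule (M : GrMod 𝒜) (j : ℤ) : Module (𝒜 0) (M.obj j) where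
  smul a m := M.act (i := 0) (by simp) a m
  one_smul m := M.one_act _ m
  mul_smul a b m := M.mul_act (i := 0) (i' := 0) (by simp) (by simp) (by simp) a b m
  smul_zero a := map_zero _
  smul_add a := map_add _
  add_smul a b m := by
    change M.act _ (a + b) m = _
    rw [map_add]; rfl
  zero_smul m := by
    change M.act _ 0 m = _
    rw [map_zero]; rfl

/-! ### Modules concentrated in one degree -/

/-- An `A₀`-module as a graded `A`-module concentrated in degree `d`. -/
def conc (V : Type u) [AddCommGroup V] [Module (𝒜 0) V] (d : ℤ) : GrMod 𝒜 where
  -- Functions on the proofs of `j = d` give `V` in degree `d` and a one-point group elsewhere, with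
  -- no transport along `j = d`.
  obj j := PLift (j = d) → V
  act {i j l} h := AddMonoidHom.mk' (fun a => AddMonoidHom.mk'
      (fun m hl => if hi : i = 0 then (⟨a, hi ▸ a.2⟩ : 𝒜 0) • m ⟨by have := hl.down; omega⟩ else 0)
      (fun x y => by
        ext hl
        by_cases hi : i = 0 <;> simp [hi]))
    (fun a b => by
      refine AddMonoidHom.ext fun x => funext fun hl => ?_
      by_cases hi : i = 0
      · simp only [hi, dite_true, AddMonoidHom.mk'_apply, AddMonoidHom.add_apply, Pi.add_apply,
          ← add_smul]
        rfl
      · simp [hi])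
  one_act h m := by
    ext hl
    simp only [dite_true, AddMonoidHom.mk'_apply]
    exact one_smul (𝒜 0) _
  mul_act {i i' j l p} h h' h'' a b m := by
    ext hl
    simp only [AddMonoidHom.mk'_apply]
    by_cases hi : i = 0
    · by_cases hi' : i' = 0
      · rw [dif_pos (by omega), dif_pos hi, dif_pos hi', smul_smul]
        rfl
      · rw [dif_neg (by omega), dif_pos hi, dif_neg hi', smul_zero]
    · rw [dif_neg (by omega), dif_neg hi]

lemma conc_act_of_eq {V : Type u} [AddCommGroup V] [Module (𝒜 0) V] {d : ℤ}
    {j l : ℤ} (h : ((0 : ℕ) : ℤ) + j = l) (a : 𝒜 0) (m : (conc (𝒜 := 𝒜) V d).obj j)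
    (hl : PLift (l = d)) :
    (conc (𝒜 := 𝒜) V d).act h a m hl = a • m ⟨by have := hl.down; omega⟩ :=
  rfl

lemma conc_act_of_ne {V : Type u} [AddCommGroup V] [Module (𝒜 0) V] {d : ℤ}
    {i : ℕ} {j l : ℤ} (h : (i : ℤ) + j = l) (hi : i ≠ 0) (a : 𝒜 i)
    (m : (conc (𝒜 := 𝒜) V d).obj j) : (conc (𝒜 := 𝒜) V d).act h a m = 0 := by
  funext hl
  exact dif_neg hi

/-- Functoriality of `conc`. -/
def concMap {V W : Type u} [AddCommGroup V] [Module (𝒜 0) V] [AddCommGroup W] [Module (𝒜 0) W]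
    (f : V →ₗ[𝒜 0] W) (d : ℤ) : conc (𝒜 := 𝒜) V d ⟶ conc W d where
  app j := AddMonoidHom.mk' (fun m hj => f (m hj)) (fun x y => by
    funext hj
    exact map_add f _ _)
  map_act {i j l} h a m := by
    funext hl
    by_cases hi : i = 0
    · subst hi
      rw [conc_act_of_eq]
      exact (congrArg f (conc_act_of_eq h a m hl)).trans (map_smul f _ _)
    · rw [conc_act_of_ne _ hi, conc_act_of_ne _ hi, map_zero]

lemma conc_shortExact {U V W : Type u} [AddCommGroup U] [Module (𝒜 0) U] [AddCommGroup V]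
    [Module (𝒜 0) V] [AddCommGroup W] [Module (𝒜 0) W] (f : U →ₗ[𝒜 0] V) (g : V →ₗ[𝒜 0] W)
    (hf : Function.Injective f) (hg : Function.Surjective g) (he : Function.Exact f g) (d : ℤ) :
    ∃ w, (ShortComplex.mk (concMap (𝒜 := 𝒜) f d) (concMap g d) w).ShortExact := by
  have w : concMap (𝒜 := 𝒜) f d ≫ concMap g d = 0 := by
    ext j m
    funext hj
    exact he.apply_apply_eq_zero _
  refine ⟨w, shortExact_of_exact _ _ w ?_ ?_ ?_⟩
  · intro j m m' h
    funext hj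
    exact hf (congrFun h hj)
  · intro j m
    choose s hs using hg
    exact ⟨fun hj => s (m hj), funext fun hj => hs _⟩
  · intro j m hm
    have (hj : PLift (j = d)) : ∃ x, f x = m hj := (he _).1 (congrFun hm hj)
    choose s hs using this
    exact ⟨s, funext hs⟩

lemma concMap_comp_eq_id {V W : Type u} [AddCommGroup V] [Module (𝒜 0) V] [AddCommGroup W]
    [Module (𝒜 0) W] (f : V →ₗ[𝒜 0] W) (g : W →ₗ[𝒜 0] V) (h : g ∘ₗ f = LinearMap.id) (d : ℤ) :
    concMap (𝒜 := 𝒜) f d ≫ concMap g d = 𝟙 _ := by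
  ext j m
  funext hj
  exact LinearMap.congr_fun h _

/-- The projection of `M` to its component of degree `d`, if `M` vanishes below `d`. -/
def toConc (M : GrMod 𝒜) (d : ℤ) (hM : ∀ j < d, Subsingleton (M.obj j)) :
    M ⟶ conc (M.obj d) d where
  app j := AddMonoidHom.mk' (fun m hj => hj.down ▸ m) (fun x y => by
    funext ⟨hj⟩
    subst hj
    rfl)
  map_act {i j l} h a m := by
    by_cases hi : i = 0
    · funext ⟨hl⟩
      subst hl hi
      obtain rfl : j = l := by simpa using h
      rw [conc_act_of_eq]
      rfl
    · rw [conc_act_of_ne _ hi]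
      funext ⟨hl⟩
      have := hM j (by omega)
      rw [Subsingleton.elim m 0, map_zero, map_zero]

lemma isIso_toConc (M : GrMod 𝒜) (d : ℤ) (hM : ∀ j, j ≠ d → Subsingleton (M.obj j)) :
    IsIso (M.toConc d fun j hj => hM j hj.ne) := by
  refine isIso_of_bijective _ fun j => ?_
  by_cases hj : j = d
  · subst hj
    exact ⟨fun x y h => congrFun h ⟨rfl⟩, fun y => ⟨y ⟨rfl⟩, rfl⟩⟩
  · have := hM j hj
    exact ⟨fun x y h => Subsingleton.elim _ _, fun y => ⟨0, funext fun h => absurd h.down hj⟩⟩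

/-! ### Truncations -/

/-- The submodule `M_{≥ n}` of `M`. -/
def trunc (M : GrMod 𝒜) (n : ℤ) : GrMod 𝒜 where
  obj j := PLift (n ≤ j) → M.obj j
  act {i j l} h := AddMonoidHom.mk' (fun a => AddMonoidHom.mk'
      (fun m _ => if hj : n ≤ j then M.act h a (m ⟨hj⟩) else 0)
      (fun x y => by
        funext hl
        by_cases hj : n ≤ j <;> simp [hj]))
    (fun a b => by
      refine AddMonoidHom.ext fun x => funext fun hl => ?_
      by_cases hj : n ≤ j <;> simp [hj])
  one_act {j} h m := by
    funext hj
    simp [hj.down, M.one_act]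
  mul_act {i i' j l p} h h' h'' a b m := by
    funext hp
    simp only [AddMonoidHom.mk'_apply]
    by_cases hj : n ≤ j
    · rw [dif_pos hj, dif_pos (by omega), dif_pos hj, M.mul_act h h' h'']
    · by_cases hl : n ≤ l
      · rw [dif_neg hj, dif_pos hl, dif_neg hj, map_zero]
      · rw [dif_neg hj, dif_neg hl]

lemma trunc_act (M : GrMod 𝒜) (n : ℤ) {i : ℕ} {j l : ℤ} (h : (i : ℤ) + j = l) (a : 𝒜 i)
    (m : (M.trunc n).obj j) (hl : PLift (n ≤ l)) (hj : n ≤ j) :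
    (M.trunc n).act h a m hl = M.act h a (m ⟨hj⟩) := dif_pos hj

lemma subsingleton_trunc (M : GrMod 𝒜) (n j : ℤ) (hj : j < n) :
    Subsingleton ((M.trunc n).obj j) :=
  ⟨fun _ _ => funext fun h => absurd h.down (not_le.2 hj)⟩

/-- The inclusion `M_{≥ n} ⟶ M`. -/
def truncι (M : GrMod 𝒜) (n : ℤ) : M.trunc n ⟶ M where
  app j := AddMonoidHom.mk' (fun m => if hj : n ≤ j then m ⟨hj⟩ else 0) (fun x y => by
    by_cases hj : n ≤ j
    · simp only [dif_pos hj]; rfl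
    · simp [hj])
  map_act {i j l} h a m := by
    simp only [AddMonoidHom.mk'_apply]
    by_cases hj : n ≤ j
    · rw [dif_pos hj, dif_pos (show n ≤ l by omega)]
      exact trunc_act _ _ _ _ _ _ hj
    · have := M.subsingleton_trunc n j (by omega)
      rw [dif_neg hj, Subsingleton.elim m 0, map_zero, map_zero]
      split_ifs <;> rfl

lemma truncι_app (M : GrMod 𝒜) (n : ℤ) {j : ℤ} (m : (M.trunc n).obj j) (hj : n ≤ j) :
    (M.truncι n).app j m = m ⟨hj⟩ := dif_pos hj

/-- One step of the dévissage: the lowest component splits off as a quotient, because `A` has no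
elements of negative degree. -/
lemma truncι_toConc_shortExact (M : GrMod 𝒜) (d : ℤ) (hM : ∀ j < d, Subsingleton (M.obj j)) :
    ∃ w, (ShortComplex.mk (M.truncι (d + 1)) (M.toConc d hM) w).ShortExact := by
  have w : M.truncι (d + 1) ≫ M.toConc d hM = 0 := by
    ext j m
    funext ⟨hj⟩
    subst hj
    have := M.subsingleton_trunc (j + 1) j (by omega)
    rw [Subsingleton.elim m 0, map_zero, map_zero]
  refine ⟨w, shortExact_of_exact _ _ w ?_ ?_ ?_⟩
  · intro j m m' h
    funext ⟨hj⟩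
    rwa [truncι_app _ _ _ hj, truncι_app _ _ _ hj] at h
  · intro j m
    by_cases hj : j = d
    · subst hj
      exact ⟨m ⟨rfl⟩, rfl⟩
    · exact ⟨0, funext fun h => absurd h.down hj⟩
  · intro j m hm
    rcases lt_trichotomy j d with hj | rfl | hj
    · have := hM j hj
      exact ⟨0, Subsingleton.elim _ _⟩
    · exact ⟨0, by rw [map_zero]; exact (congrFun hm ⟨rfl⟩).symm⟩
    · exact ⟨fun _ => m, truncι_app _ _ _ (by omega)⟩

lemma finite_trunc (M : GrMod 𝒜) (n j : ℤ) [Module.Finite (𝒜 0) (M.obj j)] :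
    Module.Finite (𝒜 0) ((M.trunc n).obj j) := by
  let f : M.obj j →ₗ[𝒜 0] (M.trunc n).obj j :=
    { toFun := fun m _ => m
      map_add' := fun _ _ => rfl
      map_smul' := fun a m => funext fun hj =>
        (trunc_act M n (i := 0) (by simp) a (fun _ => m) hj hj.down).symm }
  refine Module.Finite.of_surjective f fun m => ?_
  by_cases hj : n ≤ j
  · exact ⟨m ⟨hj⟩, rfl⟩
  · exact ⟨0, funext fun h => absurd h.down hj⟩

end GrMod

namespace GrMod

variable {k : Type v} [Field k] {A : Type u} [Ring A] [Algebra k A]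
  {𝒜 : ℕ → Submodule k A} [GradedAlgebra 𝒜]

/-! ### The graded Jacobson radical -/

open DirectSum

/-- The degree zero part of a homogeneous left ideal. -/
def zeroPart (I : HomogeneousIdeal 𝒜) : Ideal (𝒜 0) where
  carrier := {a | (a : A) ∈ I.toIdeal}
  add_mem' ha hb := I.toIdeal.add_mem ha hb
  zero_mem' := I.toIdeal.zero_mem
  smul_mem' c _ ha := I.toIdeal.mul_mem_left (c : A) ha

lemma mem_zeroPart (I : HomogeneousIdeal 𝒜) (a : 𝒜 0) : a ∈ zeroPart I ↔ (a : A) ∈ I.toIdeal :=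
  Iff.rfl

lemma decompose_mul_zero (a b : A) :
    decompose 𝒜 (a * b) 0 = decompose 𝒜 a 0 * decompose 𝒜 b 0 := by
  refine Subtype.ext ?_
  have h := map_mul (GradedRing.projZeroRingHom 𝒜) a b
  simp only [GradedRing.projZeroRingHom_apply] at h
  exact h

/-- The homogeneous left ideal `m ⊕ A_{≥ 1}` for a left ideal `m` of `A₀`. -/
def extendZero (m : Ideal (𝒜 0)) : HomogeneousIdeal 𝒜 where
  carrier := {a | decompose 𝒜 a 0 ∈ m}
  add_mem' {a b} ha hb := by
    simp only [Set.mem_ofPred_eq, decompose_add, DirectSum.add_apply] at *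
    exact m.add_mem ha hb
  zero_mem' := by simp
  smul_mem' c a ha := by
    simp only [Set.mem_ofPred_eq, smul_eq_mul, decompose_mul_zero] at *
    exact m.mul_mem_left _ ha
  is_homogeneous' i a ha := by
    change decompose 𝒜 a 0 ∈ m at ha
    change decompose 𝒜 (decompose 𝒜 a i : A) 0 ∈ m
    by_cases hi : i = 0
    · subst hi
      simpa using ha
    · have : decompose 𝒜 (decompose 𝒜 a i : A) 0 = 0 :=
        Subtype.ext (decompose_of_mem_ne 𝒜 (decompose 𝒜 a i).2 hi)
      rw [this]
      exact m.zero_mem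

lemma mem_extendZero (m : Ideal (𝒜 0)) (a : A) :
    a ∈ (extendZero m).toIdeal ↔ decompose 𝒜 a 0 ∈ m := Iff.rfl

lemma zeroPart_extendZero (m : Ideal (𝒜 0)) : zeroPart (extendZero m) = m := by
  ext a
  rw [mem_zeroPart, mem_extendZero]
  simp

lemma le_extendZero_zeroPart (I : HomogeneousIdeal 𝒜) : I ≤ extendZero (zeroPart I) :=
  fun _ ha => I.isHomogeneous 0 ha

lemma zeroPart_mono : Monotone (zeroPart (𝒜 := 𝒜)) := fun _ _ h _ ha => h ha

lemma extendZero_mono : Monotone (extendZero (𝒜 := 𝒜)) := fun _ _ h _ ha => h ha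

lemma eq_top_iff_zeroPart (I : HomogeneousIdeal 𝒜) : I = ⊤ ↔ zeroPart I = ⊤ := by
  rw [← HomogeneousIdeal.toIdeal_injective.eq_iff, HomogeneousIdeal.toIdeal_top,
    Ideal.eq_top_iff_one, Ideal.eq_top_iff_one, mem_zeroPart]
  rfl

lemma isCoatom_extendZero {m : Ideal (𝒜 0)} (hm : IsCoatom m) : IsCoatom (extendZero m) := by
  constructor
  · rw [Ne, eq_top_iff_zeroPart, zeroPart_extendZero]
    exact hm.1
  · intro K hK
    rw [eq_top_iff_zeroPart]
    refine hm.2 _ (lt_of_le_of_ne ?_ ?_)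
    · simpa only [zeroPart_extendZero] using zeroPart_mono hK.le
    · rintro rfl
      exact hK.not_ge (le_extendZero_zeroPart K)

/-- A proper homogeneous left ideal `I` stays proper after adding `A_{≥ 1}`, since properness is
tested by `1`, which has degree `0`. Maximality then leaves no room between the two. -/
lemma extendZero_zeroPart_of_isCoatom {I : HomogeneousIdeal 𝒜} (hI : IsCoatom I) :
    extendZero (zeroPart I) = I := by
  by_contra h
  have := hI.2 _ (lt_of_le_of_ne (le_extendZero_zeroPart I) (Ne.symm h))
  rw [eq_top_iff_zeroPart, zeroPart_extendZero, ← eq_top_iff_zeroPart] at this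
  exact hI.1 this

lemma isCoatom_zeroPart {I : HomogeneousIdeal 𝒜} (hI : IsCoatom I) : IsCoatom (zeroPart I) := by
  refine ⟨fun h => hI.1 ((eq_top_iff_zeroPart I).2 h), fun n hn => ?_⟩
  rw [← zeroPart_extendZero n, ← eq_top_iff_zeroPart]
  refine hI.2 _ (lt_of_le_of_ne ?_ ?_)
  · rw [← extendZero_zeroPart_of_isCoatom hI]
    exact extendZero_mono hn.le
  · rintro rfl
    rw [zeroPart_extendZero] at hn
    exact hn.ne rfl

lemma mem_gradedJacobson (a : A) :
    a ∈ (gradedJacobson 𝒜).toIdeal ↔ ∀ I : HomogeneousIdeal 𝒜, IsCoatom I → a ∈ I.toIdeal := by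
  rw [gradedJacobson, HomogeneousIdeal.toIdeal_sInf]
  simp [Submodule.mem_iInf]

lemma mem_gradedJacobson_of_mem {n : ℕ} (hn : n ≠ 0) {a : A} (ha : a ∈ 𝒜 n) :
    a ∈ (gradedJacobson 𝒜).toIdeal := by
  rw [mem_gradedJacobson]
  intro I hI
  rw [← extendZero_zeroPart_of_isCoatom hI, mem_extendZero,
    show decompose 𝒜 a 0 = 0 from Subtype.ext (decompose_of_mem_ne 𝒜 ha hn)]
  exact zero_mem _

/-- The maximal homogeneous left ideals are exactly the `m ⊕ A_{≥ 1}` with `m` a maximal left ideal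
of `A₀`; intersecting them gives `J = rad A₀ ⊕ A_{≥ 1}`. -/
lemma zeroPart_gradedJacobson : zeroPart (gradedJacobson 𝒜) = Ring.jacobson (𝒜 0) := by
  ext a
  rw [mem_zeroPart, mem_gradedJacobson, Ring.jacobson, Module.jacobson, Submodule.mem_sInf]
  constructor
  · intro h m hm
    have := h _ (isCoatom_extendZero hm)
    rwa [← mem_zeroPart, zeroPart_extendZero] at this
  · intro h I hI
    exact h _ (isCoatom_zeroPart hI)

lemma subsingleton_topMod {j : ℤ} (hj : j ≠ 0) : Subsingleton ((topMod 𝒜).obj j) := by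
  refine ⟨fun x y => ?_⟩
  suffices h : ∀ z : (topMod 𝒜).obj j, z = 0 by rw [h x, h y]
  intro z
  obtain ⟨z, rfl⟩ := QuotientAddGroup.mk_surjective z
  refine (QuotientAddGroup.eq_zero_iff _).2 ?_
  change (z : A) ∈ (gradedJacobson 𝒜).toIdeal
  obtain ⟨z, hz⟩ := z
  cases j with
  | ofNat n => exact mem_gradedJacobson_of_mem (n := n) (by rintro rfl; exact hj rfl) hz
  | negSucc n =>
    obtain rfl : z = 0 := hz
    exact zero_mem _

variable (𝒜) in
/-- The projection `A₀ → S₀`. -/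
def topModProj : 𝒜 0 →ₗ[𝒜 0] (topMod 𝒜).obj 0 where
  toFun a := QuotientAddGroup.mk' (idealComp (gradedJacobson 𝒜) 0) a
  map_add' _ _ := rfl
  map_smul' _ _ := rfl

lemma topModProj_surjective : Function.Surjective (topModProj 𝒜) :=
  QuotientAddGroup.mk_surjective

lemma ker_topModProj : LinearMap.ker (topModProj 𝒜) = Ring.jacobson (𝒜 0) := by
  rw [← zeroPart_gradedJacobson]
  ext a
  exact QuotientAddGroup.eq_zero_iff (N := idealComp (gradedJacobson 𝒜) 0) _

/-! ### Simple modules as retracts of an artinian ring modulo its radical -/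

section

variable {R M : Type*} [Ring R] [IsArtinianRing R] [AddCommGroup M] [Module R M] {π : R →ₗ[R] M}

lemma isSemisimpleModule_of_ker_eq_jacobson (hπ : Function.Surjective π)
    (hker : LinearMap.ker π = Ring.jacobson R) : IsSemisimpleModule R M := by
  have : IsArtinian R M := isArtinian_of_surjective _ _ hπ
  rw [IsArtinian.isSemisimpleModule_iff_jacobson,
    ← Module.map_jacobson_of_ker_le hπ hker.le, ← le_bot_iff, Submodule.map_le_iff_le_comap]
  exact hker.ge

/-- A simple module is generated by any `v ≠ 0`, and the radical kills `v`, so `R → V` factors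
through `M`. The resulting surjection splits because `M`, being artinian with zero radical, is
semisimple. -/
lemma exists_retract_of_ker_eq_jacobson (hπ : Function.Surjective π)
    (hker : LinearMap.ker π = Ring.jacobson R) (V : Type*) [AddCommGroup V]
    [Module R V] [IsSimpleModule R V] :
    ∃ (f : V →ₗ[R] M) (g : M →ₗ[R] V), g ∘ₗ f = LinearMap.id := by
  have := isSemisimpleModule_of_ker_eq_jacobson hπ hker
  have : Nontrivial V := IsSimpleModule.nontrivial R V
  obtain ⟨v, hv⟩ := exists_ne (0 : V)
  let p := LinearMap.toSpanSingleton R V v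
  have hp : Function.Surjective p := IsSimpleModule.toSpanSingleton_surjective R hv
  have hle : LinearMap.ker π ≤ LinearMap.ker p :=
    hker.le.trans (IsSemisimpleModule.jacobson_le_ker R R R V p)
  let g : M →ₗ[R] V := ((LinearMap.ker π).liftQ p hle) ∘ₗ
    (π.quotKerEquivOfSurjective hπ).symm.toLinearMap
  have hg : Function.Surjective g := by
    intro x
    obtain ⟨a, rfl⟩ := hp x
    refine ⟨π a, ?_⟩
    have : (π.quotKerEquivOfSurjective hπ).symm (π a) = Submodule.Quotient.mk a := by
      rw [LinearEquiv.symm_apply_eq]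
      rfl
    simp [g, this]
  obtain ⟨f, hf⟩ := IsSemisimpleModule.lifting_property g hg LinearMap.id
  exact ⟨f, g, hf⟩

end

/-! ### Finiteness of the components of `A` -/

lemma finite_regular (hfin : ∀ n, Module.Finite k (𝒜 n)) (j : ℤ) :
    Module.Finite (𝒜 0) ((regular 𝒜).obj j) := by
  have : Module.Finite k (comp 𝒜 j) := by
    cases j with
    | ofNat n => exact hfin n
    | negSucc n => exact inferInstanceAs (Module.Finite k (⊥ : Submodule k A))
  obtain ⟨s, hs⟩ := this
  refine ⟨s, eq_top_iff.2 fun (x : comp 𝒜 j) _ => ?_⟩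
  have hx : x ∈ Submodule.span k (s : Set (comp 𝒜 j)) := hs ▸ Submodule.mem_top
  -- Finitely many `k`-generators also generate over `A₀`, because `k` acts through `A₀`.
  induction hx using Submodule.span_induction with
  | mem x hx => exact Submodule.subset_span hx
  | zero => exact zero_mem _
  | add x y _ _ hx hy => exact add_mem (hx trivial) (hy trivial)
  | smul c x _ hx =>
    have h := Submodule.smul_mem _ (algebraMap k (𝒜 0) c) (hx trivial)
    rwa [show algebraMap k (𝒜 0) c • (show (regular 𝒜).obj j from x) = (c • x : comp 𝒜 j) from
      Subtype.ext (Algebra.smul_def c (x : A)).symm] at h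

end GrMod

namespace GrMod

variable {k : Type v} [Field k] {A : Type u} [Ring A] [Algebra k A]
  {𝒜 : ℕ → Submodule k A} [GradedAlgebra 𝒜]

open DirectSum

/-! ### Generators -/

/-- The component of degree `l` of the submodule generated by the family `x`. -/
def genComp (M : GrMod 𝒜) {n : ℕ} {d : Fin n → ℤ} (x : ∀ t, M.obj (d t)) (l : ℤ) :
    AddSubgroup (M.obj l) :=
  AddSubgroup.closure
    {y : M.obj l | ∃ (t : Fin n) (i : ℕ) (h : (i : ℤ) + d t = l) (a : 𝒜 i), y = M.act h a (x t)}

lemma act_mem_genComp {M : GrMod 𝒜} {n : ℕ} {d : Fin n → ℤ} (x : ∀ t, M.obj (d t)) {i : ℕ}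
    {j l : ℤ} (h : (i : ℤ) + j = l) (a : 𝒜 i) {m : M.obj j} (hm : m ∈ M.genComp x j) :
    M.act h a m ∈ M.genComp x l := by
  induction hm using AddSubgroup.closure_induction with
  | mem m hm =>
    obtain ⟨t, i', h', b, rfl⟩ := hm
    rw [← M.mul_act h' h (by push_cast; omega) a b (x t)]
    exact AddSubgroup.subset_closure ⟨t, _, _, _, rfl⟩
  | zero => rw [map_zero]; exact zero_mem _
  | add m m' _ _ hm hm' => rw [map_add]; exact add_mem hm hm'
  | neg m _ hm => rw [map_neg]; exact neg_mem hm

lemma self_mem_genComp {M : GrMod 𝒜} {n : ℕ} {d : Fin n → ℤ} (x : ∀ t, M.obj (d t)) (t : Fin n) :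
    x t ∈ M.genComp x (d t) :=
  AddSubgroup.subset_closure ⟨t, 0, by simp, _, (M.one_act (by simp) (x t)).symm⟩

lemma FinGen.of_epi {M N : GrMod 𝒜} (f : M ⟶ N) [Epi f] (hM : M.FinGen) : N.FinGen := by
  obtain ⟨n, d, x, hx⟩ := hM
  refine ⟨n, d, fun t => f.app _ (x t), fun l m => ?_⟩
  obtain ⟨m, rfl⟩ := surjective_of_epi f l m
  induction hx l m using AddSubgroup.closure_induction with
  | mem m hm =>
    obtain ⟨t, i, h, b, rfl⟩ := hm
    exact AddSubgroup.subset_closure ⟨t, i, h, b, app_act f h b _⟩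
  | zero => rw [map_zero]; exact zero_mem _
  | add m m' _ _ hm hm' => rw [map_add]; exact add_mem hm hm'
  | neg m _ hm => rw [map_neg]; exact neg_mem hm

/-! ### The free modules of rank one -/

/-- The underlying element of `A` of a homogeneous element of `A(s)`. -/
def regularVal (s l : ℤ) : ((regular 𝒜).shift s).obj l →+ A :=
  (comp 𝒜 (l + s)).toAddSubgroup.subtype

lemma regularVal_injective (s l : ℤ) : Function.Injective (regularVal (𝒜 := 𝒜) s l) :=
  Subtype.val_injective

lemma regularVal_mem (s l : ℤ) (m : ((regular 𝒜).shift s).obj l) :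
    regularVal s l m ∈ comp 𝒜 (l + s) := m.2

lemma regularVal_act (s : ℤ) {i : ℕ} {j l : ℤ} (h : (i : ℤ) + j = l) (a : 𝒜 i)
    (m : ((regular 𝒜).shift s).obj j) :
    regularVal s l (((regular 𝒜).shift s).act h a m) = a * regularVal s j m := rfl

variable (𝒜) in
/-- The generator of `A(s)`. -/
def regularGen {s d : ℤ} (h : d + s = 0) : ((regular 𝒜).shift s).obj d :=
  ⟨1, by rw [h]; exact SetLike.one_mem_graded 𝒜⟩

lemma exists_act_regularGen {s d : ℤ} (h : d + s = 0) {j : ℤ} (m : ((regular 𝒜).shift s).obj j) :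
    m = 0 ∨ ∃ (n : ℕ) (hn : (n : ℤ) + d = j) (a : 𝒜 n),
      m = ((regular 𝒜).shift s).act hn a (regularGen 𝒜 h) := by
  have hm := regularVal_mem s j m
  generalize hc : j + s = c at hm
  cases c with
  | ofNat n =>
    refine Or.inr ⟨n, by simp at hc; omega, ⟨_, hm⟩, regularVal_injective s j ?_⟩
    rw [regularVal_act]
    exact (mul_one _).symm
  | negSucc n =>
    left
    refine regularVal_injective s j ?_
    rw [map_zero]
    exact hm

lemma regular_hom_ext {s d : ℤ} (h : d + s = 0) {M : GrMod 𝒜} {f g : (regular 𝒜).shift s ⟶ M}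
    (hfg : f.app d (regularGen 𝒜 h) = g.app d (regularGen 𝒜 h)) : f = g := by
  ext j m
  obtain rfl | ⟨n, hn, a, rfl⟩ := exists_act_regularGen h m
  · rw [map_zero, map_zero]
  · rw [app_act, app_act, hfg]

/-- The action of `A_i` on `M` for `i : ℤ`. -/
def actInt (M : GrMod 𝒜) : ∀ {i j l : ℤ}, i + j = l → comp 𝒜 i →+ M.obj j →+ M.obj l
  | Int.ofNat _, _, _, h => M.act h
  | Int.negSucc _, _, _, _ => 0

lemma actInt_mul (M : GrMod 𝒜) {i : ℕ} {p q j l m : ℤ} (hq : (i : ℤ) + p = q) (hl : p + j = l)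
    (hm : q + j = m) (h : (i : ℤ) + l = m) (a : 𝒜 i) (b : comp 𝒜 p) (x : M.obj j) :
    M.actInt hm ⟨a * b, mul_mem_comp hq a.2 b.2⟩ x = M.act h a (M.actInt hl b x) := by
  subst hq
  cases p with
  | ofNat n => exact M.mul_act hl h hm a b x
  | negSucc n =>
    obtain rfl : b = 0 := Subtype.ext b.2
    have hz (h0 : a * ((0 : comp 𝒜 (Int.negSucc n)) : A) ∈ comp 𝒜 (i + Int.negSucc n)) :
        (⟨_, h0⟩ : comp 𝒜 (i + Int.negSucc n)) = 0 := Subtype.ext (mul_zero _)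
    rw [hz, map_zero, map_zero, AddMonoidHom.zero_apply, AddMonoidHom.zero_apply, map_zero]

lemma actInt_one (M : GrMod 𝒜) {i j : ℤ} (h : i + j = j) (h1 : (1 : A) ∈ comp 𝒜 i) (x : M.obj j) :
    M.actInt h ⟨1, h1⟩ x = x := by
  obtain rfl : i = 0 := by omega
  exact M.one_act h x

/-- The morphism from a free module of rank one given by an element. -/
def fromRegular {M : GrMod 𝒜} {s d : ℤ} (h : d + s = 0) (x : M.obj d) :
    (regular 𝒜).shift s ⟶ M where
  app j := (M.actInt (show j + s + d = j by omega)).flip x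
  map_act {i j l} hl a m :=
    M.actInt_mul (p := j + s) (q := l + s) (by omega) (by omega) (by omega) hl a m x

lemma fromRegular_gen {M : GrMod 𝒜} {s d : ℤ} (h : d + s = 0) (x : M.obj d) :
    (fromRegular h x).app d (regularGen 𝒜 h) = x := M.actInt_one _ _ x

lemma fromRegular_act_gen {M : GrMod 𝒜} {s d : ℤ} (h : d + s = 0) (x : M.obj d) {i : ℕ} {l : ℤ}
    (hl : (i : ℤ) + d = l) (a : 𝒜 i) :
    (fromRegular h x).app l (((regular 𝒜).shift s).act hl a (regularGen 𝒜 h)) = M.act hl a x := by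
  rw [app_act, fromRegular_gen]

instance projective_regular_shift (s : ℤ) : Projective ((regular 𝒜).shift s) where
  factors {E X} f e _ := by
    have h : -s + s = 0 := by omega
    obtain ⟨y, hy⟩ := surjective_of_epi e _ (f.app _ (regularGen 𝒜 h))
    refine ⟨fromRegular h y, regular_hom_ext h ?_⟩
    rw [comp_app, fromRegular_gen, hy]

/-! ### Noetherianity -/

lemma decompose_of_mem_comp_ne {j : ℤ} {n : ℕ} (h : j ≠ n) {a : A} (ha : a ∈ comp 𝒜 j) :
    (decompose 𝒜 a n : A) = 0 := by
  cases j with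
  | ofNat i => exact decompose_of_mem_ne 𝒜 ha (by rintro rfl; exact h rfl)
  | negSucc i =>
    obtain rfl : a = 0 := ha
    simp

lemma decompose_of_mem_comp_eq {j : ℤ} {n : ℕ} (h : j = n) {a : A} (ha : a ∈ comp 𝒜 j) :
    (decompose 𝒜 a n : A) = a := by
  subst h
  exact decompose_of_mem_same 𝒜 ha

/-- The homogeneous elements of the image span a left ideal of `A`, which by noetherianity is
spanned by finitely many of them. Taking homogeneous components in a relation `b = ∑ a_t b_t` makes
the coefficients homogeneous. -/
lemma finGen_of_mono_regular [IsNoetherianRing A] {K : GrMod 𝒜} {s : ℤ}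
    (f : K ⟶ (regular 𝒜).shift s) [Mono f] : K.FinGen := by
  let T : Set A := {b | ∃ (l : ℤ) (x : K.obj l), regularVal s l (f.app l x) = b}
  obtain ⟨t, htT, hts⟩ := (Submodule.fg_span_iff_fg_span_finset_subset (R := A) T).1
    (IsNoetherian.noetherian _)
  choose d x hx using fun i : Fin t.card => htT (t.equivFin.symm i).2
  -- The statement concerns all homogeneous components of `b`, so that it survives sums and
  -- multiplication by inhomogeneous scalars; the scalar is then decomposed in turn.
  have key : ∀ b ∈ Submodule.span A (t : Set A), ∀ (l : ℤ) (q : ℕ), l + s = q →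
      ∃ m ∈ K.genComp x l, regularVal s l (f.app l m) = decompose 𝒜 b q := by
    intro b hb
    induction hb using Submodule.span_induction with
    | mem b hb =>
      intro l q hq
      obtain ⟨i, hi⟩ := t.equivFin.symm.surjective ⟨b, hb⟩
      have hb' : regularVal s _ (f.app _ (x i)) = b := by rw [hx, hi]
      have hmem := regularVal_mem s _ (f.app _ (x i))
      rw [hb'] at hmem
      by_cases hl : l = d i
      · subst hl
        exact ⟨x i, self_mem_genComp x i, by rw [decompose_of_mem_comp_eq hq hmem, hb']⟩
      · refine ⟨0, zero_mem _, ?_⟩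
        rw [decompose_of_mem_comp_ne (by omega) hmem, map_zero, map_zero]
    | zero =>
      intro l q hq
      exact ⟨0, zero_mem _, by simp⟩
    | add b b' _ _ hb hb' =>
      intro l q hq
      obtain ⟨m, hm, h⟩ := hb l q hq
      obtain ⟨m', hm', h'⟩ := hb' l q hq
      exact ⟨m + m', add_mem hm hm', by simp [h, h']⟩
    | smul a b _ hb =>
      induction a using DirectSum.Decomposition.inductionOn 𝒜 with
      | zero =>
        intro l q hq
        exact ⟨0, zero_mem _, by simp⟩
      | @homogeneous i a =>
        intro l q hq
        by_cases hi : i ≤ q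
        · obtain ⟨m, hm, h⟩ := hb (l - i) (q - i) (by omega)
          refine ⟨K.act (by omega) a m, act_mem_genComp x _ a hm, ?_⟩
          rw [app_act, regularVal_act, h, smul_eq_mul,
            coe_decompose_mul_of_left_mem_of_le 𝒜 a.2 hi]
        · refine ⟨0, zero_mem _, ?_⟩
          rw [smul_eq_mul, coe_decompose_mul_of_left_mem_of_not_le 𝒜 a.2 hi, map_zero, map_zero]
      | add a a' ha ha' =>
        intro l q hq
        obtain ⟨m, hm, h⟩ := ha l q hq
        obtain ⟨m', hm', h'⟩ := ha' l q hq
        exact ⟨m + m', add_mem hm hm', by simp [h, h', add_mul]⟩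
  refine ⟨_, d, x, fun l m => ?_⟩
  have hm := regularVal_mem s l (f.app l m)
  generalize hc : l + s = c at hm
  cases c with
  | ofNat q =>
    obtain ⟨m', hm', h⟩ := key (regularVal s l (f.app l m))
      (hts ▸ Submodule.subset_span (s := T) ⟨l, m, rfl⟩) l q hc
    rw [decompose_of_mem_same 𝒜 hm] at h
    rwa [← injective_of_mono f l (regularVal_injective s l h)]
  | negSucc q =>
    have : m = 0 := by
      refine injective_of_mono f l (regularVal_injective s l ?_)
      rw [map_zero, map_zero]
      exact hm
    rw [this]
    exact zero_mem _

/-- Induction on the number of generators. -/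
lemma FinGen.induction {P : GrMod 𝒜 → Prop}
    (zero : ∀ M : GrMod 𝒜, IsZero M → P M)
    (cokernel_regular : ∀ (M : GrMod 𝒜) (s : ℤ) (f : (regular 𝒜).shift s ⟶ M),
      P (cokernel f) → P M) {M : GrMod 𝒜} (hM : M.FinGen) : P M := by
  obtain ⟨n, d, x, hx⟩ := hM
  induction n generalizing M with
  | zero =>
    refine zero M ((IsZero.iff_id_eq_zero M).2 ?_)
    ext l m
    rw [id_app, zero_app]
    induction hx l m using AddSubgroup.closure_induction with
    | mem m hm => exact hm.choose.elim0
    | zero => rfl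
    | add m m' _ _ hm hm' => rw [hm, hm', add_zero]
    | neg m _ hm => rw [hm, neg_zero]
  | succ n ih =>
    have h0 : d 0 + -d 0 = 0 := by omega
    let f := fromRegular h0 (x 0)
    -- The image of `f` contains the first generator, so the other `n` generate the cokernel.
    refine cokernel_regular M _ f (ih (fun t => d t.succ) (fun t => (cokernel.π f).app _ (x t.succ)) ?_)
    intro l m
    obtain ⟨m, rfl⟩ := surjective_of_epi (cokernel.π f) l m
    induction hx l m using AddSubgroup.closure_induction with
    | mem m hm =>
      obtain ⟨t, i, h, a, rfl⟩ := hm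
      induction t using Fin.cases with
      | zero =>
        rw [← fromRegular_act_gen h0 (x 0) h a, ← comp_app, cokernel.condition, zero_app]
        exact zero_mem _
      | succ t => exact AddSubgroup.subset_closure ⟨t, i, h, a, app_act _ h a _⟩
    | zero => rw [map_zero]; exact zero_mem _
    | add m m' _ _ hm hm' => rw [map_add]; exact add_mem hm hm'
    | neg m _ hm => rw [map_neg]; exact neg_mem hm

end GrMod

/-! ### Vanishing of Ext in a derived category and its long exact sequences -/

namespace DerivedCategory

open Pretriangulated

universe w v₁ u₁

variable {C : Type u₁} [Category.{v₁} C] [Abelian C] [HasDerivedCategory.{w} C]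

/-- The vanishing of `Hom(X, Y[n])`. -/
def ExtVanish (X : DerivedCategory C) (Y : C) (n : ℤ) : Prop :=
  ∀ f : X ⟶ ((singleFunctor C 0).obj Y)⟦n⟧, f = 0

namespace ExtVanish

lemma iff_subsingleton {X : DerivedCategory C} {Y : C} {n : ℤ} :
    ExtVanish X Y n ↔ Subsingleton (X ⟶ ((singleFunctor C 0).obj Y)⟦n⟧) :=
  ⟨fun h => ⟨fun f g => (h f).trans (h g).symm⟩, fun _ f => Subsingleton.elim f 0⟩

lemma of_iso {X X' : DerivedCategory C} {Y : C} {n : ℤ} (h : ExtVanish X Y n) (e : X ≅ X') :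
    ExtVanish X' Y n := fun f => by
  rw [← cancel_epi e.hom, h (e.hom ≫ f), comp_zero]

lemma of_retract {X : DerivedCategory C} {Y Z : C} {n : ℤ} (h : ExtVanish X Z n) (i : Y ⟶ Z)
    (p : Z ⟶ Y) (w : i ≫ p = 𝟙 Y) : ExtVanish X Y n := fun f => by
  have h' := h (f ≫ ((singleFunctor C 0).map i)⟦n⟧')
  have : f = (f ≫ ((singleFunctor C 0).map i)⟦n⟧') ≫ ((singleFunctor C 0).map p)⟦n⟧' := by
    rw [Category.assoc, ← Functor.map_comp, ← Functor.map_comp, w, CategoryTheory.Functor.map_id,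
      CategoryTheory.Functor.map_id, Category.comp_id]
  rw [this, h', zero_comp]

lemma of_isIso {X : DerivedCategory C} {Y Z : C} {n : ℤ} (h : ExtVanish X Z n) (f : Y ⟶ Z)
    [IsIso f] : ExtVanish X Y n :=
  h.of_retract f (inv f) (by simp)

lemma of_isZero {X : DerivedCategory C} {Y : C} {n : ℤ} (h : IsZero Y) : ExtVanish X Y n :=
  fun f => ((shiftFunctor (DerivedCategory C) n).map_isZero
    ((singleFunctor C 0).map_isZero h)).eq_of_tgt f 0

lemma of_isZero_left {X : DerivedCategory C} {Y : C} {n : ℤ} (h : IsZero X) : ExtVanish X Y n :=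
  fun f => h.eq_of_src f 0

section

variable {X : DerivedCategory C} {S : ShortComplex C} (hS : S.ShortExact) {n : ℤ}

include hS

lemma middle (h₁ : ExtVanish X S.X₁ n) (h₃ : ExtVanish X S.X₃ n) : ExtVanish X S.X₂ n := by
  intro f
  obtain ⟨g, hg⟩ := Triangle.coyoneda_exact₂ _
    (Triangle.shift_distinguished _ hS.singleTriangle_distinguished n) f (h₃ _)
  rw [hg, show g = 0 from h₁ g]
  exact zero_comp

lemma right (h₂ : ExtVanish X S.X₂ n) (h₁ : ExtVanish X S.X₁ (n + 1)) :
    ExtVanish X S.X₃ n := by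
  intro f
  let T := (Triangle.shiftFunctor (DerivedCategory C) n).obj hS.singleTriangle
  have hT : T ∈ distTriang _ :=
    Triangle.shift_distinguished _ hS.singleTriangle_distinguished n
  let e : T.obj₁⟦(1 : ℤ)⟧ ≅ ((singleFunctor C 0).obj S.X₁)⟦n + 1⟧ :=
    ((shiftFunctorAdd (DerivedCategory C) n 1).app _).symm
  have h0 : (show X ⟶ T.obj₃ from f) ≫ T.mor₃ = 0 := by
    rw [← cancel_mono e.hom, zero_comp]
    exact h₁ _
  obtain ⟨g, hg⟩ := Triangle.coyoneda_exact₃ T hT f h0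
  rw [hg, show g = 0 from h₂ g]
  exact zero_comp

end

lemma middle_left {Y : C} {n : ℤ} {T : Triangle (DerivedCategory C)} (hT : T ∈ distTriang _)
    (h₁ : ExtVanish T.obj₁ Y n) (h₃ : ExtVanish T.obj₃ Y n) : ExtVanish T.obj₂ Y n := by
  intro f
  obtain ⟨g, hg⟩ := Triangle.yoneda_exact₂ T hT f (h₁ _)
  rw [hg, h₃ g, comp_zero]

lemma shift {X : DerivedCategory C} {Y : C} {n m : ℤ} (a : ℤ) (h : n + a = m)
    (hX : ExtVanish X Y n) : ExtVanish (X⟦a⟧) Y m := by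
  intro f
  let e : ((singleFunctor C 0).obj Y)⟦m⟧ ≅ (((singleFunctor C 0).obj Y)⟦n⟧)⟦a⟧ :=
    (shiftFunctorAdd' (DerivedCategory C) n a m h).app _
  obtain ⟨g, hg⟩ := (shiftFunctor (DerivedCategory C) a).map_surjective (f ≫ e.hom)
  rw [← cancel_mono e.hom, ← hg, hX g, Functor.map_zero, zero_comp]

lemma right_left {Y : C} {n : ℤ} {T : Triangle (DerivedCategory C)} (hT : T ∈ distTriang _)
    (h₁ : ExtVanish T.obj₁ Y n) (h₂ : ExtVanish T.obj₂ Y (n + 1)) :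
    ExtVanish T.obj₃ Y (n + 1) := by
  intro f
  obtain ⟨g, hg⟩ := Triangle.yoneda_exact₃ T hT f (h₂ _)
  rw [hg, h₁.shift 1 rfl g, comp_zero]

lemma of_isLE {X : DerivedCategory C} {Y : C} {n a : ℤ} (hX : X.IsLE a) (h : a < -n) :
    ExtVanish X Y n := by
  intro f
  have : TStructure.t.IsGE (((singleFunctor C 0).obj Y)⟦n⟧) (-n) :=
    TStructure.t.isGE_shift _ 0 n (-n)
  exact TStructure.t.zero f a (-n) h

/-- The target is represented by a complex supported in degrees `≤ -n < 0`, and a projective in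
degree `0` has no nonzero map to such a complex in the derived category. -/
lemma of_projective {P Y : C} [Projective P] {n : ℤ} (hn : 0 < n) :
    ExtVanish ((singleFunctor C 0).obj P) Y n := by
  intro f
  have : TStructure.t.IsLE (((singleFunctor C 0).obj Y)⟦n⟧) (-n) :=
    TStructure.t.isLE_shift _ 0 n (-n)
  obtain ⟨K, _, ⟨e⟩⟩ := exists_iso_Q_obj_of_isLE (((singleFunctor C 0).obj Y)⟦n⟧) (-n)
  rw [← cancel_mono e.hom, zero_comp]
  exact from_singleFunctor_obj_eq_zero_of_projective (i := 0) (f ≫ e.hom) (-n) (by omega)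

lemma of_hom_eq_zero {M Y : C} (h : ∀ f : M ⟶ Y, f = 0) :
    ExtVanish ((singleFunctor C 0).obj M) Y 0 := by
  intro f
  let e := (shiftFunctorZero (DerivedCategory C) ℤ).app ((singleFunctor C 0).obj Y)
  obtain ⟨g, hg⟩ := (singleFunctor C 0).map_surjective (f ≫ e.hom)
  rw [← cancel_mono e.hom, ← hg, h g, Functor.map_zero, zero_comp]

lemma singleFunctor {M Y : C} {n a : ℤ}
    (h : ExtVanish ((DerivedCategory.singleFunctor C 0).obj M) Y (n + a)) :
    ExtVanish ((DerivedCategory.singleFunctor C a).obj M) Y n := by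
  have e : ((DerivedCategory.singleFunctor C 0).obj M)⟦-a⟧ ≅
      (DerivedCategory.singleFunctor C a).obj M :=
    ((singleFunctors C).shiftIso (-a) a 0 (by omega)).app M
  exact (h.shift (-a) (by omega)).of_iso e

end ExtVanish

/-- The truncation triangle splitting off the top cohomology. -/
lemma exists_triangle_top_homology (X : DerivedCategory C) (a : ℤ) (hX : X.IsLE a) :
    ∃ T ∈ distTriang (DerivedCategory C), T.obj₂ = X ∧ T.obj₁.IsLE (a - 1) ∧
      Nonempty (T.obj₃ ≅ (singleFunctor C a).obj ((homologyFunctor C a).obj X)) ∧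
      ∀ i < a, Nonempty ((homologyFunctor C i).obj T.obj₁ ≅ (homologyFunctor C i).obj X) := by
  let T := (TStructure.t.triangleLTGE a).obj X
  have hT : T ∈ distTriang _ := TStructure.t.triangleLTGE_distinguished a X
  have h₁ : T.obj₁.IsLE (a - 1) := inferInstanceAs
    (TStructure.t.IsLE ((TStructure.t.triangleLTGE a).obj X).obj₁ (a - 1))
  have h₃ : T.obj₃.IsGE a := inferInstanceAs
    (TStructure.t.IsGE ((TStructure.t.triangleLTGE a).obj X).obj₃ a)
  have h₃' : T.obj₃.IsLE a := by
    rw [isLE_iff]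
    -- For `i > a`, the cohomology `H^i` of the third vertex sits between `H^i(X)` and `H^{i+1}` of
    -- the first vertex, both zero.
    intro i hi
    exact (HomologySequence.exact₃ T hT i (i + 1) rfl).isZero_of_both_zeros
      ((isZero_of_isLE X a i hi).eq_of_src _ _)
      ((isZero_of_isLE T.obj₁ (a - 1) (i + 1) (by omega)).eq_of_tgt _ _)
  refine ⟨T, hT, rfl, h₁, ?_, fun i hi => ?_⟩
  · obtain ⟨Y, ⟨e⟩⟩ := exists_iso_singleFunctor_obj_of_isGE_of_isLE T.obj₃ a
    have : Mono ((homologyFunctor C a).map T.mor₂) :=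
      (HomologySequence.mono_homologyMap_mor₂_iff T hT a).2
        ((isZero_of_isLE T.obj₁ (a - 1) a (by omega)).eq_of_src _ _)
    have : Epi ((homologyFunctor C a).map T.mor₂) :=
      (HomologySequence.epi_homologyMap_mor₂_iff T hT a (a + 1) rfl).2
        ((isZero_of_isLE T.obj₁ (a - 1) (a + 1) (by omega)).eq_of_tgt _ _)
    have hi := isIso_of_mono_of_epi ((homologyFunctor C a).map T.mor₂)
    let e' : (homologyFunctor C a).obj X ≅ Y :=
      @asIso _ _ _ _ ((homologyFunctor C a).map T.mor₂) hi ≪≫ (homologyFunctor C a).mapIso e ≪≫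
        (singleFunctorCompHomologyFunctorIso C a).app Y
    exact ⟨e ≪≫ (singleFunctor C a).mapIso e'.symm⟩
  · have : Mono ((homologyFunctor C i).map T.mor₁) :=
      (HomologySequence.mono_homologyMap_mor₁_iff T hT (i - 1) i (by omega)).2
        ((isZero_of_isGE T.obj₃ a (i - 1) (by omega)).eq_of_src _ _)
    have : Epi ((homologyFunctor C i).map T.mor₁) :=
      (HomologySequence.epi_homologyMap_mor₁_iff T hT i).2
        ((isZero_of_isGE T.obj₃ a i hi).eq_of_tgt _ _)
    have hi := isIso_of_mono_of_epi ((homologyFunctor C i).map T.mor₁)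
    exact ⟨@asIso _ _ _ _ ((homologyFunctor C i).map T.mor₁) hi⟩

end DerivedCategory

namespace GrMod

variable {k : Type v} [Field k] {A : Type u} [Ring A] [Algebra k A]
  {𝒜 : ℕ → Submodule k A} [GradedAlgebra 𝒜]

open DerivedCategory

/-! ### Vanishing of Ext into modules living in high degrees -/

/-- A map `A(s) ⟶ M` hitting one generator need not be injective; together with
`image_cokernel_shortExact` this cuts it into two short exact sequences. -/
lemma kernel_factorThruImage_shortExact {C : Type*} [Category* C] [Abelian C] {X Y : C}
    (f : X ⟶ Y) : ∃ w, (ShortComplex.mk (kernel.ι f) (Abelian.factorThruImage f) w).ShortExact := by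
  have w : kernel.ι f ≫ Abelian.factorThruImage f = 0 := by
    rw [← cancel_mono (Abelian.image.ι f), Category.assoc, Abelian.image.fac, kernel.condition,
      zero_comp]
  let S := ShortComplex.mk (kernel.ι f) f (kernel.condition f)
  let φ : ShortComplex.mk _ _ w ⟶ S :=
    { τ₁ := 𝟙 _
      τ₂ := 𝟙 _
      τ₃ := Abelian.image.ι f }
  have : Epi φ.τ₁ := inferInstanceAs (Epi (𝟙 _))
  have : IsIso φ.τ₂ := inferInstanceAs (IsIso (𝟙 _))
  have : Mono φ.τ₃ := inferInstanceAs (Mono (Abelian.image.ι f))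
  have h : S.Exact := ShortComplex.exact_of_f_is_kernel _ (kernelIsKernel f)
  exact ⟨w, { exact := (ShortComplex.exact_iff_of_epi_of_isIso_of_mono φ).2 h
              mono_f := inferInstanceAs (Mono (kernel.ι f))
              epi_g := inferInstanceAs (Epi (Abelian.factorThruImage f)) }⟩

lemma image_cokernel_shortExact {C : Type*} [Category* C] [Abelian C] {X Y : C} (f : X ⟶ Y) :
    (ShortComplex.mk (Abelian.image.ι f) (cokernel.π f) (kernel.condition _)).ShortExact :=
  { exact := ShortComplex.exact_of_f_is_kernel _ (kernelIsKernel (cokernel.π f))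
    mono_f := inferInstanceAs (Mono (Abelian.image.ι f))
    epi_g := inferInstanceAs (Epi (cokernel.π f)) }

/-- For `q = 0`, a morphism is determined by the image of the generator, which has degree `-s`,
where `Y` vanishes; for `q > 0`, the source is projective. -/
lemma regular_shift_extVanish (s : ℤ) (q : ℕ) {Y : GrMod 𝒜}
    (hY : ∀ m < -s + 1, Subsingleton (Y.obj m)) :
    ExtVanish ((singleFunctor (GrMod 𝒜) 0).obj ((regular 𝒜).shift s)) Y q := by
  rcases Nat.eq_zero_or_pos q with rfl | hq
  · refine ExtVanish.of_hom_eq_zero fun f => regular_hom_ext (d := -s) (by omega) ?_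
    have := hY (-s) (by omega)
    exact Subsingleton.elim _ _
  · exact ExtVanish.of_projective (by omega)

/-- Dimension shifting in `q`, with an inner induction on the number of generators. For `f : A(s) ⟶
M`, the kernel is again finitely generated and is handled one Ext degree lower, while the cokernel
has fewer generators. The exponent `q - 1` makes the base case a negative Ext group, which is always
zero. -/
lemma FinGen.exists_extVanish [IsNoetherianRing A] (q : ℕ) {M : GrMod 𝒜} (hM : M.FinGen) :
    ∃ n : ℤ, ∀ Y : GrMod 𝒜, (∀ m < n, Subsingleton (Y.obj m)) →
      ExtVanish ((singleFunctor (GrMod 𝒜) 0).obj M) Y (q - 1) := by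
  induction q generalizing M with
  | zero =>
    exact ⟨0, fun Y _ => ExtVanish.of_isLE (a := 0) inferInstance (by simp)⟩
  | succ q ih =>
    refine hM.induction (P := fun M => ∃ n : ℤ, ∀ Y : GrMod 𝒜, (∀ m < n, Subsingleton (Y.obj m)) →
      ExtVanish ((singleFunctor (GrMod 𝒜) 0).obj M) Y (((q + 1 : ℕ) : ℤ) - 1)) (fun M hM => ⟨0, fun Y _ => ?_⟩) fun M s f ⟨n₃, h₃⟩ => ?_
    · exact ExtVanish.of_isZero_left ((singleFunctor (GrMod 𝒜) 0).map_isZero hM)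
    · obtain ⟨n₁, h₁⟩ := ih (finGen_of_mono_regular (kernel.ι f))
      obtain ⟨w, hS⟩ := kernel_factorThruImage_shortExact f
      refine ⟨max n₁ (max n₃ (-s + 1)), fun Y hY => ?_⟩
      have h₂ := regular_shift_extVanish s q (Y := Y) fun m hm => hY m (by simp [hm])
      have e : ((q + 1 : ℕ) : ℤ) - 1 = (q : ℤ) - 1 + 1 := by push_cast; ring
      have hI : ExtVanish ((singleFunctor (GrMod 𝒜) 0).obj (Abelian.image f)) Y
          (((q + 1 : ℕ) : ℤ) - 1) := by
        rw [e]
        refine ExtVanish.right_left hS.singleTriangle_distinguished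
          (h₁ Y fun m hm => hY m (by simp [hm])) ?_
        rwa [sub_add_cancel]
      exact ExtVanish.middle_left (image_cokernel_shortExact f).singleTriangle_distinguished hI
        (h₃ Y fun m hm => hY m (by simp [hm]))

/-- Cohomology in degrees `< -i` does not contribute to `Ext^i` into a module, so only the finitely
many degrees from `-i` to the upper bound matter. Each of them is a finitely generated module. -/
lemma IsDMinusFG.exists_extVanish [IsNoetherianRing A] {X : DerivedCategory (GrMod 𝒜)}
    (hX : IsDMinusFG X) (i : ℤ) : ∃ n : ℤ, ∀ Y : GrMod 𝒜,
      (∀ m < n, Subsingleton (Y.obj m)) → ExtVanish X Y i := by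
  obtain ⟨⟨N, hN⟩, hfg⟩ := hX
  have hN' : X.IsLE N := (isLE_iff X N).2 hN
  -- `c` counts the cohomological degrees `≥ -i` that remain to be split off.
  have key : ∀ (c : ℕ) (X : DerivedCategory (GrMod 𝒜)), X.IsLE (-i - 1 + c) →
      (∀ i, (cohomology X i).FinGen) → ∃ n : ℤ, ∀ Y : GrMod 𝒜,
        (∀ m < n, Subsingleton (Y.obj m)) → ExtVanish X Y i := by
    intro c
    induction c with
    | zero => exact fun X hX _ => ⟨0, fun Y _ => ExtVanish.of_isLE hX (by simp)⟩
    | succ c ih =>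
      intro X hX hfg
      obtain ⟨T, hT, rfl, h₁, ⟨e⟩, h⟩ := exists_triangle_top_homology X _ hX
      obtain ⟨n, hn⟩ := ih T.obj₁ (by convert h₁ using 1; push_cast; ring) fun j => by
        rcases lt_or_ge j (-i - 1 + (c + 1 : ℕ)) with hj | hj
        · obtain ⟨e⟩ := h j hj
          exact FinGen.of_epi e.inv (hfg j)
        · have := (isZero_of_isLE T.obj₁ (-i - 1 + (c + 1 : ℕ) - 1) j (by omega)).epi (0 : cohomology T.obj₂ j ⟶ _)
          exact FinGen.of_epi (0 : cohomology T.obj₂ j ⟶ _) (hfg j)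
      -- The top cohomology sits in degree `-i + c`, so its `Ext^i` is the module-theoretic `Ext^c`,
      -- and `c = (c + 1) - 1`.
      obtain ⟨n', hn'⟩ := (hfg (-i - 1 + (c + 1 : ℕ))).exists_extVanish (c + 1)
      refine ⟨max n n', fun Y hY => ExtVanish.middle_left hT
        (hn Y fun m hm => hY m (by simp [hm])) ?_⟩
      refine ExtVanish.of_iso (ExtVanish.singleFunctor ?_) e.symm
      convert hn' Y fun m hm => hY m (by simp [hm]) using 1
      push_cast
      ring
  have : X.IsLE (-i - 1 + (N + i + 1).toNat) :=
    TStructure.t.isLE_of_le X N _ (by have := Int.self_le_toNat (N + i + 1); omega)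
  exact key _ X this hfg

/-! ### Dévissage -/

variable {X : DerivedCategory (GrMod 𝒜)}

/-- The index `e` stands for `d + s`, the degree of a shifted component, which equals `0` only
propositionally. -/
lemma exists_retract_topMod [IsArtinianRing (𝒜 0)] (V : Type u) [AddCommGroup V]
    [Module (𝒜 0) V] [IsSimpleModule (𝒜 0) V] {e : ℤ} (he : e = 0) :
    ∃ (f : V →ₗ[𝒜 0] (topMod 𝒜).obj e) (g : (topMod 𝒜).obj e →ₗ[𝒜 0] V),
      g ∘ₗ f = LinearMap.id := by
  subst he
  exact exists_retract_of_ker_eq_jacobson topModProj_surjective ker_topModProj V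

lemma exists_retract_regular [IsSemisimpleRing (𝒜 0)] {e : ℤ} (he : e = 0) :
    ∃ (f : (topMod 𝒜).obj e →ₗ[𝒜 0] (regular 𝒜).obj e)
      (g : (regular 𝒜).obj e →ₗ[𝒜 0] (topMod 𝒜).obj e), g ∘ₗ f = LinearMap.id := by
  subst he
  obtain ⟨f, hf⟩ := IsSemisimpleModule.lifting_property (topModProj 𝒜) topModProj_surjective
    LinearMap.id
  exact ⟨f, topModProj 𝒜, hf⟩

lemma subsingleton_topMod_shift {s l : ℤ} (h : l + s ≠ 0) :
    Subsingleton (((topMod 𝒜).shift s).obj l) := subsingleton_topMod h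

lemma topMod_isIso_toConc {s d : ℤ} (h : d + s = 0) :
    IsIso (((topMod 𝒜).shift s).toConc d fun _ hj => subsingleton_topMod_shift (by omega)) :=
  isIso_toConc _ _ fun _ hj => subsingleton_topMod_shift (by omega)

lemma extVanish_conc_of_isSimpleModule [IsArtinianRing (𝒜 0)] {s d i : ℤ} (hs : d + s = 0)
    (h : ExtVanish X ((topMod 𝒜).shift s) i) (V : Type u) [AddCommGroup V] [Module (𝒜 0) V]
    [IsSimpleModule (𝒜 0) V] : ExtVanish X (conc V d) i := by
  obtain ⟨f, g, hfg⟩ := exists_retract_topMod (𝒜 := 𝒜) V hs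
  have := topMod_isIso_toConc (𝒜 := 𝒜) hs
  have h' : ExtVanish X (conc (((topMod 𝒜).shift s).obj d) d) i := h.of_isIso (inv (toConc _ _ _))
  exact h'.of_retract (concMap f d) (concMap g d) (concMap_comp_eq_id f g hfg d)

lemma extVanish_conc [IsArtinianRing (𝒜 0)] {s d i : ℤ} (hs : d + s = 0)
    (h : ExtVanish X ((topMod 𝒜).shift s) i) (V : Type u) [AddCommGroup V] [Module (𝒜 0) V]
    (hV : IsFiniteLength (𝒜 0) V) : ExtVanish X (conc V d) i := by
  induction hV with
  | of_subsingleton =>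
    refine ExtVanish.of_isZero ((IsZero.iff_id_eq_zero _).2 ?_)
    ext l m
    funext
    exact Subsingleton.elim _ _
  | @of_simple_quotient M _ _ N _ _ ih =>
    obtain ⟨w, hS⟩ := conc_shortExact (𝒜 := 𝒜) N.subtype N.mkQ N.subtype_injective
      N.mkQ_surjective (LinearMap.exact_subtype_mkQ N) d
    exact ExtVanish.middle hS ih (extVanish_conc_of_isSimpleModule hs h _)

/-- Lowest components are peeled off one at a time, each of finite length in some degree `d ≥ b` and
so controlled by `S(-d)` with `-d ≤ -b`. The process stops at degree `n`, beyond which `Ext^i(X, -)`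
vanishes for every module. -/
lemma extVanish_of_topMod [IsNoetherianRing A] [IsArtinianRing (𝒜 0)] (hX : IsDMinusFG X)
    {i b : ℤ} (h : ∀ s ≤ -b, ExtVanish X ((topMod 𝒜).shift s) i) {Y : GrMod 𝒜}
    (hY : ∀ l < b, Subsingleton (Y.obj l)) (hfin : ∀ l, Module.Finite (𝒜 0) (Y.obj l)) :
    ExtVanish X Y i := by
  obtain ⟨n, hn⟩ := hX.exists_extVanish i
  have key : ∀ (c : ℕ) (d : ℤ) (Y : GrMod 𝒜), b ≤ d → n ≤ d + c →
      (∀ l < d, Subsingleton (Y.obj l)) → (∀ l, Module.Finite (𝒜 0) (Y.obj l)) →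
      ExtVanish X Y i := by
    intro c
    induction c with
    | zero => exact fun d Y _ hd hY _ => hn Y fun m hm => hY m (by omega)
    | succ c ih =>
      intro d Y hb hd hY hfin
      obtain ⟨w, hS⟩ := Y.truncι_toConc_shortExact d hY
      exact ExtVanish.middle hS
        (ih (d + 1) _ (by omega) (by push_cast at hd; omega)
          (fun l hl => Y.subsingleton_trunc _ l hl) fun l => Y.finite_trunc _ l)
        (extVanish_conc (s := -d) (by omega) (h _ (by omega)) _
          (isFiniteLength_iff_isNoetherian_isArtinian.2 ⟨inferInstance, inferInstance⟩))
  exact key (n - b).toNat b Y le_rfl (by have := Int.self_le_toNat (n - b); omega) hY hfin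

lemma subsingleton_regular {j : ℤ} (hj : j < 0) : Subsingleton ((regular 𝒜).obj j) := by
  cases j with
  | ofNat n => exact absurd hj (by simp)
  | negSucc n => exact inferInstanceAs (Subsingleton (⊥ : Submodule k A))

lemma subsingleton_regular_shift {s l : ℤ} (h : l + s < 0) :
    Subsingleton (((regular 𝒜).shift s).obj l) := subsingleton_regular h

lemma isArtinianRing_zero [Module.Finite k (𝒜 0)] : IsArtinianRing (𝒜 0) :=
  have : IsScalarTower k (𝒜 0) (𝒜 0) := ⟨fun c a b => Subtype.ext (smul_mul_assoc c (a : A) b)⟩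
  IsArtinianRing.of_finite k (𝒜 0)

lemma finite_regular_shift (hfin : ∀ n, Module.Finite k (𝒜 n)) (s l : ℤ) :
    Module.Finite (𝒜 0) (((regular 𝒜).shift s).obj l) := finite_regular hfin (l + s)

lemma extVanish_regular (hfin : ∀ n, Module.Finite k (𝒜 n)) [IsNoetherianRing A]
    (hX : IsDMinusFG X) {i j : ℤ} (h : ∀ s ≤ j, ExtVanish X ((topMod 𝒜).shift s) i) :
    ExtVanish X ((regular 𝒜).shift j) i := by
  have := hfin 0
  have := isArtinianRing_zero (𝒜 := 𝒜)
  exact extVanish_of_topMod hX (b := -j) (fun s hs => h s (by omega))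
    (fun l hl => subsingleton_regular_shift (by omega)) (finite_regular_shift hfin j)

/-- In the long exact sequence of `A(j)_{≥ -j+1} ⟶ A(j) ⟶ A₀`, with `A₀` in degree `-j`, both
neighbours of `Ext^i(X, A₀)` vanish. By semisimplicity `S(j)` is a retract of this `A₀`. -/
lemma extVanish_topMod_of_regular (hfin : ∀ n, Module.Finite k (𝒜 n)) [IsNoetherianRing A]
    [IsSemisimpleRing (𝒜 0)] (hX : IsDMinusFG X) {i j : ℤ}
    (h : ∀ s < j, ExtVanish X ((topMod 𝒜).shift s) (i + 1))
    (h' : ExtVanish X ((regular 𝒜).shift j) i) : ExtVanish X ((topMod 𝒜).shift j) i := by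
  have := hfin 0
  have := isArtinianRing_zero (𝒜 := 𝒜)
  have h0 : -j + j = 0 := by omega
  have hY : ∀ l < -j, Subsingleton (((regular 𝒜).shift j).obj l) :=
    fun l hl => subsingleton_regular_shift (by omega)
  have hf := finite_regular_shift hfin j
  obtain ⟨w, hS⟩ := ((regular 𝒜).shift j).truncι_toConc_shortExact (-j) hY
  have h₁ : ExtVanish X (((regular 𝒜).shift j).trunc (-j + 1)) (i + 1) :=
    extVanish_of_topMod hX (b := -j + 1) (fun s hs => h s (by omega))
      (fun l hl => subsingleton_trunc _ _ l hl) fun l => finite_trunc _ _ l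
  have h₃ := ExtVanish.right hS h' h₁
  obtain ⟨f, g, hfg⟩ := exists_retract_regular (𝒜 := 𝒜) h0
  have h₄ : ExtVanish X (conc (((topMod 𝒜).shift j).obj (-j)) (-j)) i :=
    h₃.of_retract (concMap f (-j)) (concMap g (-j)) (concMap_comp_eq_id f g hfg (-j))
  have := topMod_isIso_toConc (𝒜 := 𝒜) h0
  exact h₄.of_isIso (toConc _ _ _)

/-! ### The regularity -/

lemma nontrivial_gExt_iff {Y : GrMod 𝒜} {i j : ℤ} :
    Nontrivial (gExt X Y i j) ↔ ¬ ExtVanish X (Y.shift j) i := by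
  rw [ExtVanish.iff_subsingleton, not_subsingleton_iff_nontrivial]

lemma idegRHom_le {Y : GrMod 𝒜} {i j : ℤ} (h : ¬ ExtVanish X (Y.shift j) i) :
    idegRHom X Y ≤ ((i + j : ℤ) : ℝ) :=
  sInf_le ⟨i, j, nontrivial_gExt_iff.2 h, rfl⟩

lemma idegRHom_topMod_le (hfin : ∀ n, Module.Finite k (𝒜 n)) [IsNoetherianRing A]
    (hX : IsDMinusFG X) : idegRHom X (topMod 𝒜) ≤ idegRHom X (regular 𝒜) := by
  refine le_sInf ?_
  rintro _ ⟨i, j, hij, rfl⟩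
  rw [nontrivial_gExt_iff] at hij
  by_contra hlt
  refine hij (extVanish_regular hfin hX fun s hs => ?_)
  by_contra hs'
  refine hlt ((idegRHom_le hs').trans ?_)
  exact_mod_cast show i + s ≤ i + j by omega

lemma exists_bound_of_pdim_lt_top (h : pdim X < ⊤) :
    ∃ p : ℤ, ∀ (i : ℤ) (Y : GrMod 𝒜) (j : ℤ), ¬ ExtVanish X (Y.shift j) i → i ≤ p := by
  obtain ⟨r, hr, -⟩ := EReal.lt_iff_exists_real_btwn.1 h
  refine ⟨⌈r⌉, fun i Y j hij => ?_⟩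
  have h1 : (((i : ℤ) : ℝ) : EReal) ≤ pdim X :=
    le_sSup ⟨i, Y, ⟨j, nontrivial_gExt_iff.2 hij⟩, rfl⟩
  have h2 : ((i : ℤ) : ℝ) < r := by exact_mod_cast h1.trans_lt hr
  exact_mod_cast (h2.le.trans (Int.le_ceil r))

/-- Only finitely many `i` occur, between minus the upper bound of the cohomology and the bound
given by `pdim`. For each of them `j > -n i`, since `S(j)` lives in degree `-j`. -/
lemma exists_lower_bound [IsNoetherianRing A] (hX : IsDMinusFG X) (h : pdim X < ⊤) :
    ∃ B : ℤ, ∀ i j : ℤ, ¬ ExtVanish X ((topMod 𝒜).shift j) i → B ≤ i + j := by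
  obtain ⟨p, hp⟩ := exists_bound_of_pdim_lt_top h
  obtain ⟨N, hN⟩ := hX.1
  have hN' : X.IsLE N := (isLE_iff X N).2 hN
  choose n hn using hX.exists_extVanish
  obtain ⟨B, hB⟩ := ((Finset.Icc (-N) p).image fun i => i - n i).bddBelow
  refine ⟨B, fun i j hij => ?_⟩
  have h1 : i ≤ p := hp i _ j hij
  have h2 : -N ≤ i := by
    by_contra hlt
    exact hij (ExtVanish.of_isLE hN' (by omega))
  have h3 : -j < n i := by
    by_contra hlt
    exact hij (hn i _ fun m hm => subsingleton_topMod_shift (by omega))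
  have : B ≤ i - n i := hB (Finset.mem_coe.2
    (Finset.mem_image_of_mem _ (Finset.mem_Icc.2 ⟨h2, h1⟩)))
  omega

lemma idegRHom_regular_le (hfin : ∀ n, Module.Finite k (𝒜 n)) [IsNoetherianRing A]
    [IsSemisimpleRing (𝒜 0)] (hX : IsDMinusFG X) (h : pdim X < ⊤) :
    idegRHom X (regular 𝒜) ≤ idegRHom X (topMod 𝒜) := by
  by_cases hne : ∃ e i j : ℤ, ¬ ExtVanish X ((topMod 𝒜).shift j) i ∧ i + j = e
  · obtain ⟨B, hB⟩ := exists_lower_bound hX h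
    obtain ⟨p, hp⟩ := exists_bound_of_pdim_lt_top h
    obtain ⟨e, ⟨i₀, j₀, hij₀, he₀⟩, hmin⟩ := Int.exists_least_of_bdd
      ⟨B, fun e ⟨i, j, hij, he⟩ => he ▸ hB i j hij⟩ hne
    -- Among the pairs of least sum `e`, the largest `i` ensures that no class in `Ext^{i+1}` has
    -- total degree `e`.
    obtain ⟨i, ⟨j, hij, he⟩, hmax⟩ := Int.exists_greatest_of_bdd
      (P := fun i => ∃ j, ¬ ExtVanish X ((topMod 𝒜).shift j) i ∧ i + j = e)
      ⟨p, fun i ⟨j, hij, _⟩ => hp i _ j hij⟩ ⟨i₀, j₀, hij₀, he₀⟩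
    have hA : ¬ ExtVanish X ((regular 𝒜).shift j) i := by
      refine fun hA => hij (extVanish_topMod_of_regular hfin hX (fun s hs => ?_) hA)
      by_contra hs'
      -- Minimality gives `e ≤ i + 1 + s`, while `s < j` gives `i + 1 + s ≤ e`; so the sum is
      -- exactly `e`, contradicting the choice of `i`.
      have h1 := hmin (i + 1 + s) ⟨_, _, hs', rfl⟩
      have h2 := hmax (i + 1) ⟨s, hs', by omega⟩
      omega
    refine (idegRHom_le hA).trans (le_sInf ?_)
    rintro _ ⟨i', j', hij', rfl⟩
    have := hmin _ ⟨i', j', nontrivial_gExt_iff.1 hij', rfl⟩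
    exact_mod_cast show i + j ≤ i' + j' by omega
  -- All `Ext^i(X, S)_j` vanish, so the right-hand side is the infimum of the empty set, `+∞`.
  · refine le_sInf ?_
    rintro _ ⟨i, j, hij, rfl⟩
    exact absurd ⟨_, i, j, nontrivial_gExt_iff.1 hij, rfl⟩ hne

end GrMod

end

theorem theorem3p15 {k : Type v} [Field k] {A : Type u} [Ring A] [Algebra k A]
    (𝒜 : ℕ → Submodule k A) [GradedAlgebra 𝒜]
    (hfin : ∀ n, Module.Finite k (𝒜 n)) (hnoeth : IsNoetherianRing A) :
    (∀ X : DerivedCategory (GrMod 𝒜), GrMod.IsDMinusFG X → ¬ IsZero X →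
      - GrMod.idegRHom X (GrMod.regular 𝒜) ≤ GrMod.extReg X) ∧
    (IsSemisimpleRing (𝒜 0) →
      ∀ X : DerivedCategory (GrMod 𝒜), GrMod.IsDBoundedFG X → ¬ IsZero X → GrMod.pdim X < ⊤ →
        GrMod.extReg X = - GrMod.idegRHom X (GrMod.regular 𝒜)) := by
  refine ⟨fun X hX _ => EReal.neg_le_neg_iff.2 (GrMod.idegRHom_topMod_le hfin hX),
    fun _ X hX _ hp => ?_⟩
  have hX' : GrMod.IsDMinusFG X := ⟨hX.1, hX.2.2⟩
  exact congrArg _ ((GrMod.idegRHom_topMod_le hfin hX').antisymm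
    (GrMod.idegRHom_regular_le hfin hX' hp))
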